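/- Let $n\ge 1$, let $\Omega\subset\mathbb R^n$ be a bounded open set, and let $2\le p<\infty$, $1<q\le p$. Let $\bm a:\Omega\times\mathbb R^n\to\mathbb R^n$ be a Carathéodory function (measurable in $x$, continuous in $\xi$), let $H:\Omega\times\mathbb R\times\mathbb R^n\to\mathbb R$ be continuous, and let $\gamma,\sigma>0$. Assume: **(a-e)** $(\bm a(x,\xi)-\bm a(x,\eta))\cdot(\xi-\eta)\ge\gamma|\xi-\eta|^r$ for all $x\in\Omega$, $\xi,\eta\in\mathbb R^n$ and all $r\in[\max(2,q),p]$. **(H-1)** $H(x,t,\xi)-H(x,s,\xi)\ge\omega(x,t-s)+\tau(x,t-s)|\xi|^\sigma$ for all $x\in\Omega$, $\xi\in\mathbb R^n$, $s<t$, where $\omega,\tau:\Omega\times(0,\infty)\to\mathbb R$ are non-negative, lower semicontinuous in $x\in\Omega$ and non-decreasing in $r\in(0,\infty)$. **(H-2)** For every compact $K\subset\Omega$ there is $M=M(K)>0$ with $|H(x,t,\eta)-H(x,t,\xi)|\le M\,\bigl||\eta|^\sigma-|\xi|^\sigma\bigr|$ for all $x\in K$, $t\in\mathbb R$, $\xi,\eta\in\mathbb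 R^n$. If the functions $u,v$ below belong to $L^\infty_{loc}(\Omega)$, the following weaker version is enough: for all compact $K\subset\Omega$ and $J\subset\mathbb R$ there is $M=M(K,J)>0$ such that the inequality holds for all $x\in K$, $t\in J$, $\xi,\eta\in\mathbb R^n$. For $Qu:=-\operatorname{div}(\bm a(x,\nabla u))+H(x,u,\nabla u)$, the inequality $Qu\le Qv$ in $\Omega$ means that $$\int_\Omega(\bm a(x,\nabla u)-\bm a(x,\nabla v))\cdot\nabla\varphi\le\int_\Omega(H(x,v,\nabla v)-H(x,u,\nabla u))\varphi$$ for all $\varphi\in C^1_c(\Omega)$ with $\varphi\ge0$, where $\nabla u,\nabla v$ are weak gradients; $u\le v$ on $\partial\Omega$ means $\limsup_{x\to\partial\Omega}(u(x)-v(x))\le0$ (essential limsup); $u\le v$ in $\Omega$ means almost everywhere. Suppose that either * (i) $u,v\in W^{1,p}_{loc}(\Omega)$ with $|\bm a(x,\nabla u)|,|\bm a(x,\nabla v)|,H(x,u,0),H(x,v,0)\in L^{p/(p-1)}_{loc}(\Omega)$, or $u,v\in W^{1,\infty}_{loc}(\Omega)$ with these four functions in $L^1_{loc}(\Omega)$;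 and one of the following holds: * **A$_1$**: $0<\sigma\le1$, $\omega>0$; * **A$_{2a}$**: $1\le\sigma\le\max(q,2)-1$, $\omega>0$ and $\tau>0$; * **A$_{2b}$**: $\max(q,2)-1\le\sigma\le p-1$, $\tau>0$; * **A$_3$**: $p-1\le\sigma\le p$, $\tau>0$ and $\operatorname{ess\,sup}_\Omega(u-v)<\infty$; or * (ii) $u,v\in W^{1,\infty}_{loc}(\Omega)$ with these four functions in $L^1_{loc}(\Omega)$, and **A$_4$**: $p\le\sigma$, $\tau>0$. If $Qu\le Qv$ in $\Omega$ and $u\le v$ on $\partial\Omega$, then $u\le v$ in $\Omega$. Moreover, the $(p,q)$-Laplacian is covered: the field $\bm a(x,\xi)=|\xi|^{p-2}\xi+|\xi|^{q-2}\xi$ is a Carathéodory function and satisfies (a-e) with some constant $\gamma>0$. -/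

import Mathlib

open MeasureTheory Set
open scoped ENNReal

noncomputable section

namespace PQComparison

/-- The Euclidean space `ℝⁿ`. -/
abbrev Rn (n : ℕ) : Type := EuclideanSpace ℝ (Fin n)

variable {n : ℕ}

/-- `f ∈ L^s_loc(Ω)`: `f` is in `L^s(K)` for every compact `K ⊆ Ω`. -/
def LocMemLp {F : Type*} [NormedAddCommGroup F] (Ω : Set (Rn n)) (s : ℝ≥0∞) (f : Rn n → F) :
    Prop :=
  ∀ K : Set (Rn n), K ⊆ Ω → IsCompact K → MemLp f s (volume.restrict K)

/-- `Du` satisfies the integration by parts formula that defines the weak gradient of `u` in `Ω`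
(local integrability of `u` and `Du` is required separately, in `MemW1Loc`). -/
def IsWeakGradient (Ω : Set (Rn n)) (u : Rn n → ℝ) (Du : Rn n → Rn n) : Prop :=
  ∀ φ : Rn n → ℝ, ContDiff ℝ (⊤ : ℕ∞) φ → HasCompactSupport φ → tsupport φ ⊆ Ω →
    ∫ x in Ω, u x • gradient φ x = -∫ x in Ω, φ x • Du x

/-- `u ∈ W^{1,s}_loc(Ω)`, with weak gradient `Du` (unique up to a null set). -/
structure MemW1Loc (Ω : Set (Rn n)) (s : ℝ≥0∞) (u : Rn n → ℝ) (Du : Rn n → Rn n) : Prop where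
  memLp : LocMemLp Ω s u
  memLp_grad : LocMemLp Ω s Du
  isWeakGradient : IsWeakGradient Ω u Du

/-- Carathéodory vector fields on `Ω × ℝⁿ`: (Lebesgue) measurable in `x`, continuous in `ξ`. -/
structure IsCaratheodory (Ω : Set (Rn n)) (a : Rn n → Rn n → Rn n) : Prop where
  measurable : ∀ ξ, AEMeasurable (fun x => a x ξ) (volume.restrict Ω)
  continuous : ∀ x ∈ Ω, Continuous (a x)

/-- The ellipticity condition for `p ≥ 2`, with constant `γ`. -/
def EllipticityCond (Ω : Set (Rn n)) (p q γ : ℝ) (a : Rn n → Rn n → Rn n) : Prop :=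
  ∀ r ∈ Icc (max 2 q) p, ∀ x ∈ Ω, ∀ ξ η : Rn n,
    γ * ‖ξ - η‖ ^ r ≤ inner ℝ (a x ξ - a x η) (ξ - η)

/-- Functions `ω` on `Ω × (0,∞)` that are non-negative, lower semicontinuous in `x` and
non-decreasing in `r`. -/
structure IsModulus (Ω : Set (Rn n)) (ω : Rn n → ℝ → ℝ) : Prop where
  nonneg : ∀ x ∈ Ω, ∀ r : ℝ, 0 < r → 0 ≤ ω x r
  lsc : ∀ r : ℝ, 0 < r → LowerSemicontinuousOn (fun x => ω x r) Ω
  mono : ∀ x ∈ Ω, MonotoneOn (ω x) (Ioi 0)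

/-- `ω > 0` on `Ω × (0,∞)`. -/
def PosModulus (Ω : Set (Rn n)) (ω : Rn n → ℝ → ℝ) : Prop :=
  ∀ x ∈ Ω, ∀ r : ℝ, 0 < r → 0 < ω x r

/-- Condition (H-1): the monotonicity of `H` in its second argument. -/
structure CondH1 (Ω : Set (Rn n)) (H : Rn n → ℝ → Rn n → ℝ) (ω τ : Rn n → ℝ → ℝ) (σ : ℝ) :
    Prop where
  omega : IsModulus Ω ω
  tau : IsModulus Ω τ
  ineq : ∀ x ∈ Ω, ∀ ξ : Rn n, ∀ s t : ℝ, s < t →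
    ω x (t - s) + τ x (t - s) * ‖ξ‖ ^ σ ≤ H x t ξ - H x s ξ

/-- Condition (H-2), with a constant `M = M(K)`. -/
def CondH2 (Ω : Set (Rn n)) (H : Rn n → ℝ → Rn n → ℝ) (σ : ℝ) : Prop :=
  ∀ K : Set (Rn n), K ⊆ Ω → IsCompact K → ∃ M : ℝ, 0 < M ∧
    ∀ x ∈ K, ∀ t : ℝ, ∀ ξ η : Rn n, |H x t η - H x t ξ| ≤ M * |‖η‖ ^ σ - ‖ξ‖ ^ σ|

/-- The weaker version of condition (H-2), with a constant `M = M(K, J)`. -/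
def CondH2Weak (Ω : Set (Rn n)) (H : Rn n → ℝ → Rn n → ℝ) (σ : ℝ) : Prop :=
  ∀ K : Set (Rn n), K ⊆ Ω → IsCompact K → ∀ J : Set ℝ, IsCompact J → ∃ M : ℝ, 0 < M ∧
    ∀ x ∈ K, ∀ t ∈ J, ∀ ξ η : Rn n, |H x t η - H x t ξ| ≤ M * |‖η‖ ^ σ - ‖ξ‖ ^ σ|

/-- `u ∈ W^{1,s}_loc(Ω)` with the consistency assumption
`|a(x,∇u)|, H(x,u,0) ∈ L^{s'}_loc(Ω)`, which makes the integrals in `WeakLE` well defined. -/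
structure Admissible (Ω : Set (Rn n)) (s s' : ℝ≥0∞) (a : Rn n → Rn n → Rn n)
    (H : Rn n → ℝ → Rn n → ℝ) (u : Rn n → ℝ) (Du : Rn n → Rn n) : Prop where
  memW1Loc : MemW1Loc Ω s u Du
  field : LocMemLp Ω s' (fun x => a x (Du x))
  hamiltonian : LocMemLp Ω s' (fun x => H x (u x) 0)

/-- The inequality `Qu ≤ Qv` in the weak sense, where `Qu = -div a(x,∇u) + H(x,u,∇u)`. -/
def WeakLE (Ω : Set (Rn n)) (a : Rn n → Rn n → Rn n) (H : Rn n → ℝ → Rn n → ℝ)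
    (u : Rn n → ℝ) (Du : Rn n → Rn n) (v : Rn n → ℝ) (Dv : Rn n → Rn n) : Prop :=
  ∀ φ : Rn n → ℝ, ContDiff ℝ 1 φ → HasCompactSupport φ → tsupport φ ⊆ Ω → (∀ x, 0 ≤ φ x) →
    ∫ x in Ω, inner ℝ (a x (Du x) - a x (Dv x)) (gradient φ x) ≤
      ∫ x in Ω, (H x (v x) (Dv x) - H x (u x) (Du x)) * φ x

/-- `u ≤ v` on `∂Ω`: `limsup (u(x) - v(x)) ≤ 0` as `dist(x, ∂Ω) → 0`, `x ∈ Ω` (the functions being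
defined almost everywhere). -/
def BoundaryLE (Ω : Set (Rn n)) (u v : Rn n → ℝ) : Prop :=
  ∀ ε : ℝ, 0 < ε → ∃ δ : ℝ, 0 < δ ∧
    ∀ᵐ x ∂(volume.restrict Ω), Metric.infDist x (frontier Ω) < δ → u x - v x ≤ ε

/-- The vector field `|ξ|^{p-2} ξ + |ξ|^{q-2} ξ` of the `(p,q)`-Laplacian. -/
def pqField (n : ℕ) (p q : ℝ) : Rn n → Rn n → Rn n :=
  fun _ ξ => ‖ξ‖ ^ (p - 2) • ξ + ‖ξ‖ ^ (q - 2) • ξ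

end PQComparison

end

open PQComparison

/-! ### Power inequalities in `ℝⁿ` and the ellipticity of the `(p,q)`-Laplacian. -/

namespace PQComparison

/-! Fix `k₀ > 0`. The boundary condition confines `{u - v > k₀}` to a compact set `K₀ ⊆ Ω`, so
multiplying by a cutoff gives a compactly supported Sobolev function `z` that equals `u - v` on `K₀`
and exceeds `k₀` only there. The goal is `z ≤ k₀`; then `k₀` tends to `0`.

Test the inequality with `(z - k)₊`, `k ≥ k₀` (`integral_inner_grad_le` admits this Sobolev test
function by mollification). Ellipticity bounds the left side below by `γ ∫ |D(z - k)₊|^r`. For the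
right side, (H-1) and (H-2) give `H(x,v,∇v) - H(x,u,∇u) ≤ C|Dz|^(r-1) + C'|Dz|^r` where `z > k`
(`exists_growth_bound`): positivity of `τ` absorbs the part of the gradient increment that is small
relative to `|∇u|`, positivity of `ω` absorbs powers that are too low, and `r` in `[max(2,q), p]` is
chosen according to `σ`. Young's inequality absorbs the first term; the second is needed only when
`u - v` is bounded above, and is absorbed because `(z - k)₊` is small for `k` near the essential
supremum. Hence (`energy_le`) `∫ |D(z - k)₊|^r` is at most a constant, independent of `k`, times the
integral of `(z - k)₊^r` over `{z > k, Dz ≠ 0}`.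

As `k` approaches the essential supremum of `z`, finite or not, the measure of that set tends to
`0`: in the finite case `Dz = 0` almost everywhere on the set where the supremum is attained
(`MemW1Supported.ae_grad_eq_zero_of_eq`, `MemW1Supported.exists_level`). A Poincaré inequality whose
constant is small on sets of small measure (`exists_poincare_small`) then gives `D(z - k)₊ = 0`, so
`z ≤ k` with `k` below the essential supremum, a contradiction
(`MemW1Supported.ae_le_of_energy_le`).

For the `(p,q)`-Laplacian, the two ends of the range of `r` are treated separately and the rest is
interpolation (`pqField_ellipticity`). -/

/-- Interpolation: a power between two others is bounded by their sum. -/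
lemma rpow_le_rpow_add_rpow {t a b r : ℝ} (ht : 0 ≤ t) (ha : 0 < a) (h₁ : a ≤ r) (h₂ : r ≤ b) :
    t ^ r ≤ t ^ a + t ^ b := by
  rcases le_total t 1 with h | h
  · have := Real.rpow_le_rpow_of_exponent_ge' ht h ha.le h₁
    have := Real.rpow_nonneg ht b
    linarith
  · have := Real.rpow_le_rpow_of_exponent_le h h₂
    have := Real.rpow_nonneg ht a
    linarith

/-- Symmetrizing the two weights separates a quadratic term in `ξ - η` from a radial term, which is
non-negative for `s ≥ 0` because both powers increase. -/
lemma inner_rpow_smul_sub {n : ℕ} (s : ℝ) (ξ η : Rn n) :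
    inner ℝ (‖ξ‖ ^ s • ξ - ‖η‖ ^ s • η) (ξ - η) =
      (‖ξ‖ ^ s + ‖η‖ ^ s) / 2 * ‖ξ - η‖ ^ 2 +
        (‖ξ‖ ^ s - ‖η‖ ^ s) * (‖ξ‖ ^ 2 - ‖η‖ ^ 2) / 2 := by
  rw [norm_sub_sq_real]
  simp only [inner_sub_left, inner_sub_right, real_inner_smul_left, real_inner_self_eq_norm_sq]
  rw [real_inner_comm ξ η]
  ring

lemma rpow_sub_mul_sq_sub_nonneg {s a b : ℝ} (hs : 0 ≤ s) (ha : 0 ≤ a) (hb : 0 ≤ b) :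
    0 ≤ (a ^ s - b ^ s) * (a ^ 2 - b ^ 2) := by
  rcases le_total a b with h | h
  · have h1 := Real.rpow_le_rpow ha h hs
    have h2 : a ^ 2 ≤ b ^ 2 := by gcongr
    nlinarith
  · have h1 := Real.rpow_le_rpow hb h hs
    have h2 : b ^ 2 ≤ a ^ 2 := by gcongr
    nlinarith

/-- The degenerate monotonicity estimate, in its weighted form. -/
lemma le_inner_rpow_smul_sub_of_nonneg {n : ℕ} {s : ℝ} (hs : 0 ≤ s) (ξ η : Rn n) :
    (max ‖ξ‖ ‖η‖) ^ s / 2 * ‖ξ - η‖ ^ 2 ≤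
      inner ℝ (‖ξ‖ ^ s • ξ - ‖η‖ ^ s • η) (ξ - η) := by
  rw [inner_rpow_smul_sub]
  have h := rpow_sub_mul_sq_sub_nonneg hs (norm_nonneg ξ) (norm_nonneg η)
  have h1 := Real.rpow_nonneg (norm_nonneg ξ) s
  have h2 := Real.rpow_nonneg (norm_nonneg η) s
  have : (max ‖ξ‖ ‖η‖) ^ s ≤ ‖ξ‖ ^ s + ‖η‖ ^ s := by
    rcases max_cases ‖ξ‖ ‖η‖ with h | h <;> rw [h.1] <;> linarith
  have := mul_le_mul_of_nonneg_right this (sq_nonneg ‖ξ - η‖)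
  linarith

/-- Since `‖ξ - η‖ / 2` is at most the larger norm, the weight in the degenerate estimate is at
least `(‖ξ - η‖ / 2) ^ (p - 2)`. -/
lemma rpow_le_inner_rpow_smul_sub {n : ℕ} {p : ℝ} (hp : 2 ≤ p) (ξ η : Rn n) :
    (1 / 2) ^ (p - 2) / 2 * ‖ξ - η‖ ^ p ≤
      inner ℝ (‖ξ‖ ^ (p - 2) • ξ - ‖η‖ ^ (p - 2) • η) (ξ - η) := by
  refine le_trans ?_ (le_inner_rpow_smul_sub_of_nonneg (by linarith) ξ η)
  have h1 : 1 / 2 * ‖ξ - η‖ ≤ max ‖ξ‖ ‖η‖ := by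
    have := norm_sub_le ξ η
    have := le_max_left ‖ξ‖ ‖η‖
    have := le_max_right ‖ξ‖ ‖η‖
    linarith
  have h2 : (1 / 2 * ‖ξ - η‖) ^ (p - 2) ≤ (max ‖ξ‖ ‖η‖) ^ (p - 2) :=
    Real.rpow_le_rpow (by positivity) h1 (by linarith)
  have h3 : ‖ξ - η‖ ^ p = ‖ξ - η‖ ^ (p - 2) * ‖ξ - η‖ ^ 2 := by
    rcases (norm_nonneg (ξ - η)).eq_or_lt with h | h
    · rw [← h, Real.zero_rpow (by linarith)]; simp
    · rw [← Real.rpow_natCast, ← Real.rpow_add h]; norm_num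
  rw [h3, Real.mul_rpow (by norm_num) (norm_nonneg _)] at *
  have := mul_le_mul_of_nonneg_right h2 (sq_nonneg ‖ξ - η‖)
  linarith

/-- The scalar monotonicity estimate for exponents below one, on the unit interval. -/
lemma mul_sub_le_rpow_sub_rpow {α a b : ℝ} (hα : 0 < α) (hα1 : α ≤ 1) (hb : 0 ≤ b) (hab : b ≤ a)
    (ha : a ≤ 1) : α * (a - b) ≤ a ^ α - b ^ α := by
  rcases (hb.trans hab).eq_or_lt with h | h
  · have : b = 0 := by linarith
    subst this; simp [← h]
  -- Bernoulli's inequality (concavity of the power) at the ratio `b / a`; `a ≤ a ^ α` on the unit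
  -- interval then undoes the scaling.
  have h1 : (1 + (b / a - 1)) ^ α ≤ 1 + α * (b / a - 1) :=
    rpow_one_add_le_one_add_mul_self (by linarith [div_nonneg hb h.le]) hα.le hα1
  have h2 : b = b / a * a := by field_simp
  have h3 : b ^ α = (b / a) ^ α * a ^ α := by
    conv_lhs => rw [h2]
    rw [Real.mul_rpow (by positivity) h.le]
  have h4 : a ≤ a ^ α := by
    simpa using Real.rpow_le_rpow_of_exponent_ge h ha hα1
  have h5 : 0 ≤ 1 - b / a := by rw [sub_nonneg, div_le_one h]; exact hab
  rw [h3]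
  rw [add_sub_cancel] at h1
  have h6 : α * (a - b) = α * (1 - b / a) * a := by field_simp
  rw [h6]
  have h7 : α * (1 - b / a) * a ≤ α * (1 - b / a) * a ^ α := by gcongr
  have h8 := mul_le_mul_of_nonneg_right h1 (Real.rpow_nonneg h.le α)
  linarith

/-- A radial part plus a weighted Cauchy–Schwarz defect. Both are non-negative for every `q > 1`,
whereas the radial term of `inner_rpow_smul_sub` has the wrong sign for `q < 2`. -/
lemma inner_rpow_smul_sub_eq {n : ℕ} {q : ℝ} (hq : 1 < q) (ξ η : Rn n) :
    inner ℝ (‖ξ‖ ^ (q - 2) • ξ - ‖η‖ ^ (q - 2) • η) (ξ - η) =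
      (‖ξ‖ ^ (q - 1) - ‖η‖ ^ (q - 1)) * (‖ξ‖ - ‖η‖) +
        (‖ξ‖ ^ (q - 2) + ‖η‖ ^ (q - 2)) * (‖ξ‖ * ‖η‖ - inner ℝ ξ η) := by
  have key : ∀ a : ℝ, 0 ≤ a → a ^ (q - 2) * a = a ^ (q - 1) := by
    intro a ha
    rcases ha.eq_or_lt with h | h
    · rw [← h, Real.zero_rpow (x := q - 1) (by linarith)]; simp
    · nth_rw 2 [← Real.rpow_one a]
      rw [← Real.rpow_add h]; ring_nf
  rw [← key _ (norm_nonneg ξ), ← key _ (norm_nonneg η)]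
  simp only [inner_sub_left, inner_sub_right, real_inner_smul_left, real_inner_self_eq_norm_sq]
  rw [real_inner_comm ξ η]
  ring

lemma inner_rpow_smul_sub_nonneg {n : ℕ} {q : ℝ} (hq : 1 < q) (ξ η : Rn n) :
    0 ≤ inner ℝ (‖ξ‖ ^ (q - 2) • ξ - ‖η‖ ^ (q - 2) • η) (ξ - η) := by
  rw [inner_rpow_smul_sub_eq hq]
  have hcs := real_inner_le_norm ξ η
  have h1 : 0 ≤ (‖ξ‖ ^ (q - 1) - ‖η‖ ^ (q - 1)) * (‖ξ‖ - ‖η‖) := by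
    rcases le_total ‖η‖ ‖ξ‖ with h | h
    · have := Real.rpow_le_rpow (norm_nonneg _) h (by linarith : 0 ≤ q - 1)
      nlinarith
    · have := Real.rpow_le_rpow (norm_nonneg _) h (by linarith : 0 ≤ q - 1)
      nlinarith
  have h2 : 0 ≤ (‖ξ‖ ^ (q - 2) + ‖η‖ ^ (q - 2)) * (‖ξ‖ * ‖η‖ - inner ℝ ξ η) :=
    mul_nonneg (by positivity) (by linarith)
  linarith

/-- In the unit ball the singular weights are at least `1` and the radial difference quotient is at
least `q - 1`. These bound the two parts of `‖ξ - η‖² = (‖ξ‖ - ‖η‖)² + 2 (‖ξ‖ ‖η‖ - ⟨ξ, η⟩)`. -/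
lemma sq_le_inner_rpow_smul_sub {n : ℕ} {q : ℝ} (hq : 1 < q) (hq2 : q ≤ 2) {ξ η : Rn n}
    (hξ : ‖ξ‖ ≤ 1) (hη : ‖η‖ ≤ 1) :
    (q - 1) * ‖ξ - η‖ ^ 2 ≤
      inner ℝ (‖ξ‖ ^ (q - 2) • ξ - ‖η‖ ^ (q - 2) • η) (ξ - η) := by
  have hlow : ∀ a : ℝ, 0 < a → a ≤ 1 → 1 ≤ a ^ (q - 2) := fun a ha ha1 =>
    Real.one_le_rpow_of_pos_of_le_one_of_nonpos ha ha1 (by linarith)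
  have hmon : (q - 1) * (‖ξ‖ - ‖η‖) ^ 2 ≤
      (‖ξ‖ ^ (q - 1) - ‖η‖ ^ (q - 1)) * (‖ξ‖ - ‖η‖) := by
    rcases le_total ‖η‖ ‖ξ‖ with h | h
    · have := mul_sub_le_rpow_sub_rpow (α := q - 1) (by linarith) (by linarith) (norm_nonneg η) h hξ
      nlinarith
    · have := mul_sub_le_rpow_sub_rpow (α := q - 1) (by linarith) (by linarith) (norm_nonneg ξ) h hη
      nlinarith
  have hcs := real_inner_le_norm ξ η
  have hrest : 2 * (q - 1) * (‖ξ‖ * ‖η‖ - inner ℝ ξ η) ≤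
      (‖ξ‖ ^ (q - 2) + ‖η‖ ^ (q - 2)) * (‖ξ‖ * ‖η‖ - inner ℝ ξ η) := by
    -- At the origin a negative power has the default value `0`, so the lower bound for the weight
    -- fails there, but the Cauchy–Schwarz defect vanishes.
    rcases (norm_nonneg ξ).eq_or_lt with h | h
    · have : ξ = 0 := norm_eq_zero.1 h.symm
      simp [this]
    rcases (norm_nonneg η).eq_or_lt with h' | h'
    · have : η = 0 := norm_eq_zero.1 h'.symm
      simp [this]
    have h1 := hlow _ h hξ
    have h2 := hlow _ h' hη
    exact mul_le_mul_of_nonneg_right (by linarith) (by linarith)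
  rw [inner_rpow_smul_sub_eq hq, norm_sub_sq_real]
  nlinarith

/-- The `p`-term controls the exponent `p`. The exponent `max 2 q` comes from the `q`-term if `q ≥
2`; if `q ≤ 2` it is `2`, handled by the singular `q`-term in the unit ball and outside it by the
`p`-term, whose weight is then at least a constant. -/
lemma pqField_ellipticity {n : ℕ} (Ω : Set (Rn n)) {p q : ℝ} (hp : 2 ≤ p) (hq : 1 < q) :
    ∃ γ : ℝ, 0 < γ ∧ EllipticityCond Ω p q γ (pqField n p q) := by
  set cp : ℝ := (1 / 2) ^ (p - 2) / 2 with hcp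
  have hcp0 : 0 < cp := by positivity
  have hsplit : ∀ (x ξ η : Rn n), inner ℝ (pqField n p q x ξ - pqField n p q x η) (ξ - η) =
      inner ℝ (‖ξ‖ ^ (p - 2) • ξ - ‖η‖ ^ (p - 2) • η) (ξ - η) +
      inner ℝ (‖ξ‖ ^ (q - 2) • ξ - ‖η‖ ^ (q - 2) • η) (ξ - η) := by
    intro x ξ η
    rw [← inner_add_left]; congr 1; simp only [pqField]; abel
  -- it suffices to treat the two extreme exponents
  suffices h : ∃ c : ℝ, 0 < c ∧ ∀ ξ η : Rn n, c * ‖ξ - η‖ ^ (max 2 q) ≤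
      inner ℝ (‖ξ‖ ^ (p - 2) • ξ - ‖η‖ ^ (p - 2) • η) (ξ - η) +
      inner ℝ (‖ξ‖ ^ (q - 2) • ξ - ‖η‖ ^ (q - 2) • η) (ξ - η) by
    obtain ⟨c, hc, h⟩ := h
    -- The factor `1 / 2` pays for using the `p`-term twice, once for each extreme exponent.
    refine ⟨min c cp / 2, by positivity, fun r hr x _ ξ η => ?_⟩
    rw [hsplit]
    have h1 := h ξ η
    have h2 := rpow_le_inner_rpow_smul_sub hp ξ η
    have h3 := inner_rpow_smul_sub_nonneg hq ξ η
    have h4 := rpow_le_rpow_add_rpow (norm_nonneg (ξ - η)) (a := max 2 q) (by positivity) hr.1 hr.2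
    have h5 : min c cp * ‖ξ - η‖ ^ (max 2 q) ≤ c * ‖ξ - η‖ ^ (max 2 q) := by
      gcongr; exact min_le_left _ _
    have h6 : min c cp * ‖ξ - η‖ ^ p ≤ cp * ‖ξ - η‖ ^ p := by
      gcongr; exact min_le_right _ _
    have h7 : min c cp * ‖ξ - η‖ ^ r ≤
        min c cp * (‖ξ - η‖ ^ (max 2 q) + ‖ξ - η‖ ^ p) := by gcongr
    rw [← hcp] at h2
    linarith
  rcases le_total 2 q with h2 | h2
  · rw [max_eq_right h2]
    refine ⟨(1 / 2) ^ (q - 2) / 2, by positivity, fun ξ η => ?_⟩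
    have h1 := inner_rpow_smul_sub_nonneg (by linarith : 1 < p) ξ η
    have h3 := rpow_le_inner_rpow_smul_sub h2 ξ η
    linarith
  · rw [max_eq_left h2]
    refine ⟨min (q - 1) (1 / 2), by simpa using hq, fun ξ η => ?_⟩
    rw [show (2 : ℝ) = (2 : ℕ) by norm_num, Real.rpow_natCast]
    have hd := sq_nonneg ‖ξ - η‖
    by_cases hm : max ‖ξ‖ ‖η‖ ≤ 1
    · have h1 := inner_rpow_smul_sub_nonneg (by linarith : 1 < p) ξ η
      have h3 := sq_le_inner_rpow_smul_sub hq h2 (le_trans (le_max_left _ _) hm)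
        (le_trans (le_max_right _ _) hm)
      have h4 := mul_le_mul_of_nonneg_right (min_le_left (q - 1) (1 / 2)) hd
      push_cast at *
      linarith
    · have h1 := inner_rpow_smul_sub_nonneg hq ξ η
      have h3 := le_inner_rpow_smul_sub_of_nonneg (by linarith : 0 ≤ p - 2) ξ η
      have h4 := mul_le_mul_of_nonneg_right (min_le_right (q - 1) (1 / 2)) hd
      have h5 : 1 ≤ (max ‖ξ‖ ‖η‖) ^ (p - 2) :=
        Real.one_le_rpow (not_le.1 hm).le (by linarith)
      have h6 := mul_le_mul_of_nonneg_right h5 hd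
      push_cast at *
      linarith

/-- Only the origin matters when `q < 2`: there the field has norm `‖ξ‖ ^ (q - 1)`, which tends to
`0`. -/
lemma continuous_norm_rpow_smul {n : ℕ} {q : ℝ} (hq : 1 < q) :
    Continuous fun ξ : Rn n => ‖ξ‖ ^ (q - 2) • ξ := by
  rw [continuous_iff_continuousAt]
  intro ξ
  by_cases hξ : ξ = 0
  · subst hξ
    have h0 : ‖(0 : Rn n)‖ ^ (q - 2) • (0 : Rn n) = 0 := smul_zero _
    rw [ContinuousAt, h0]
    refine squeeze_zero_norm (a := fun ξ : Rn n => ‖ξ‖ ^ (q - 1)) (fun ξ => ?_) ?_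
    · rw [norm_smul, Real.norm_of_nonneg (by positivity)]
      rcases (norm_nonneg ξ).eq_or_lt with h | h
      · rw [← h, Real.zero_rpow (x := q - 1) (by linarith)]; simp
      · nth_rw 2 [← Real.rpow_one ‖ξ‖]
        rw [← Real.rpow_add h]; ring_nf; rfl
    · have : Continuous fun ξ : Rn n => ‖ξ‖ ^ (q - 1) :=
        continuous_norm.rpow_const fun _ => Or.inr (by linarith)
      simpa [Real.zero_rpow (by linarith : q - 1 ≠ 0)] using this.tendsto 0
  · exact (continuousAt_id.norm.rpow_const (Or.inl (by simpa using hξ))).smul continuousAt_id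

lemma pqField_isCaratheodory {n : ℕ} (Ω : Set (Rn n)) {p q : ℝ} (hp : 1 < p) (hq : 1 < q) :
    IsCaratheodory Ω (pqField n p q) where
  measurable _ := aemeasurable_const
  continuous _ _ := (continuous_norm_rpow_smul hp).add (continuous_norm_rpow_smul hq)

/-! ### Scalar inequalities for the lower order terms. -/

/-- Under a relative smallness condition, differences of powers are absorbed by the power. -/
lemma exists_abs_rpow_sub_rpow_le {σ τ M : ℝ} (hσ : 0 < σ) (hτ : 0 < τ) (hM : 0 < M) :
    ∃ C : ℝ, 0 < C ∧ ∀ a b t : ℝ, 0 ≤ a → 0 ≤ b → |a - b| ≤ t →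
      M * |b ^ σ - a ^ σ| ≤ τ * a ^ σ + C * t ^ σ := by
  have hc : ContinuousAt (fun s : ℝ => s ^ σ) 1 := Real.continuousAt_rpow_const _ _ (Or.inr hσ.le)
  obtain ⟨ε, hε, h⟩ := Metric.continuousAt_iff.1 hc (τ / M) (by positivity)
  simp only [Real.one_rpow, Real.dist_eq] at h
  refine ⟨M * (1 + 2 / ε) ^ σ, by positivity, fun a b t ha hb ht => ?_⟩
  have ht0 : 0 ≤ t := (abs_nonneg _).trans ht
  -- If `t` is small relative to `a`, then `b / a` is close to `1` and continuity of the power at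
  -- `1` gives the factor `τ / M`; otherwise both `a` and `b` are at most `(1 + 2 / ε) * t`.
  by_cases hcase : 2 * t ≤ ε * a
  · rcases ha.eq_or_lt with h0 | h0
    · have : t = 0 := by rw [← h0] at hcase; linarith
      have hb0 : a - b = 0 := by rw [this] at ht; exact abs_nonpos_iff.1 ht
      rw [show b = a by linarith]; simp; positivity
    have h1 : |b / a - 1| < ε := by
      rw [div_sub_one h0.ne', abs_div, abs_of_pos h0, div_lt_iff₀ h0, abs_sub_comm]
      have : 0 < ε * a := by positivity
      linarith
    have h2 := (h h1).le
    have h3 : b ^ σ = (b / a) ^ σ * a ^ σ := by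
      rw [← Real.mul_rpow (by positivity) ha]; congr 1; field_simp
    have h4 : |b ^ σ - a ^ σ| = |(b / a) ^ σ - 1| * a ^ σ := by
      rw [h3, ← sub_one_mul, abs_mul, abs_of_nonneg (Real.rpow_nonneg ha σ)]
    rw [h4]
    have h5 : M * (|(b / a) ^ σ - 1| * a ^ σ) ≤ M * (τ / M * a ^ σ) := by gcongr
    have h6 : M * (τ / M * a ^ σ) = τ * a ^ σ := by field_simp
    have : 0 ≤ M * (1 + 2 / ε) ^ σ * t ^ σ := by positivity
    linarith
  · have h1 : a ≤ 2 / ε * t := by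
      rw [div_mul_eq_mul_div, le_div_iff₀ hε]; linarith
    have h2 : b ≤ (1 + 2 / ε) * t := by
      have := (abs_le.1 ht).1
      linarith
    have h3 : a ≤ (1 + 2 / ε) * t := by linarith
    have h4 : |b ^ σ - a ^ σ| ≤ ((1 + 2 / ε) * t) ^ σ := by
      have := Real.rpow_le_rpow hb h2 hσ.le
      have := Real.rpow_le_rpow ha h3 hσ.le
      have := Real.rpow_nonneg hb σ
      have := Real.rpow_nonneg ha σ
      rw [abs_le]; constructor <;> linarith
    rw [Real.mul_rpow (by positivity) ht0] at h4
    have : 0 ≤ τ * a ^ σ := by positivity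
    have := mul_le_mul_of_nonneg_left h4 hM.le
    linarith

/-- Subadditivity of `t ↦ t ^ σ` for `σ ≤ 1`, used in both directions. In this range no positivity
of `τ` is needed. -/
lemma abs_rpow_sub_rpow_le {σ a b t : ℝ} (hσ : 0 < σ) (hσ1 : σ ≤ 1) (ha : 0 ≤ a) (hb : 0 ≤ b)
    (ht : |a - b| ≤ t) : |b ^ σ - a ^ σ| ≤ t ^ σ := by
  have ht0 : 0 ≤ t := (abs_nonneg _).trans ht
  have h := abs_le.1 ht
  have h1 : b ^ σ ≤ a ^ σ + t ^ σ :=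
    (Real.rpow_le_rpow hb (by linarith) hσ.le).trans (Real.rpow_add_le_add_rpow ha ht0 hσ.le hσ1)
  have h2 : a ^ σ ≤ b ^ σ + t ^ σ :=
    (Real.rpow_le_rpow ha (by linarith) hσ.le).trans (Real.rpow_add_le_add_rpow hb ht0 hσ.le hσ1)
  rw [abs_le]; constructor <;> linarith

/-- A lower power is bounded by a small constant plus a multiple of a higher one. -/
lemma exists_mul_rpow_le_add {σ e C ω : ℝ} (hσ : 0 < σ) (he : σ ≤ e) (hC : 0 < C) (hω : 0 < ω) :
    ∃ C' : ℝ, 0 < C' ∧ ∀ t : ℝ, 0 ≤ t → C * t ^ σ ≤ ω + C' * t ^ e := by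
  -- The threshold at which `C * t ^ σ` reaches `ω`: below it the constant suffices, above it `t ^
  -- (σ - e) ≤ c ^ (σ - e)`.
  set c : ℝ := (ω / C) ^ σ⁻¹ with hc
  have hc0 : 0 < c := by positivity
  have hcσ : c ^ σ = ω / C := by
    rw [hc, ← Real.rpow_mul (by positivity), inv_mul_cancel₀ hσ.ne', Real.rpow_one]
  refine ⟨C * c ^ (σ - e), by positivity, fun t ht => ?_⟩
  rcases le_total t c with h | h
  · have h1 := Real.rpow_le_rpow ht h hσ.le
    rw [hcσ] at h1
    have h2 : C * t ^ σ ≤ C * (ω / C) := by gcongr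
    have h3 : C * (ω / C) = ω := by field_simp
    have : 0 ≤ C * c ^ (σ - e) * t ^ e := by positivity
    linarith
  · have ht0 : 0 < t := hc0.trans_le h
    have h1 : t ^ (σ - e) ≤ c ^ (σ - e) :=
      Real.rpow_le_rpow_of_nonpos hc0 h (by linarith)
    have h2 : t ^ σ = t ^ (σ - e) * t ^ e := by rw [← Real.rpow_add ht0]; ring_nf
    have h3 : C * t ^ σ ≤ C * c ^ (σ - e) * t ^ e := by rw [h2, ← mul_assoc]; gcongr
    linarith

/-- A form of Young's inequality. -/
lemma exists_rpow_mul_le_add {r C γ : ℝ} (hr : 1 < r) (hC : 0 ≤ C) (hγ : 0 < γ) :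
    ∃ C' : ℝ, 0 < C' ∧ ∀ t z : ℝ, 0 ≤ t → 0 ≤ z →
      C * t ^ (r - 1) * z ≤ γ * t ^ r + C' * z ^ r := by
  -- The constant comes from splitting at `(C + 1) * z = γ * t`; `C + 1` replaces `C` to keep it
  -- positive when `C = 0`.
  refine ⟨(C + 1) * ((C + 1) / γ) ^ (r - 1), by positivity, fun t z ht hz => ?_⟩
  have key : ∀ s : ℝ, 0 ≤ s → s ^ r = s ^ (r - 1) * s := by
    intro s hs
    rcases hs.eq_or_lt with h | h
    · rw [← h, Real.zero_rpow (by linarith)]; simp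
    · nth_rw 3 [← Real.rpow_one s]
      rw [← Real.rpow_add h]; ring_nf
  have h0 : C * t ^ (r - 1) * z ≤ (C + 1) * t ^ (r - 1) * z := by gcongr; linarith
  refine h0.trans ?_
  rw [key t ht, key z hz]
  rcases le_total ((C + 1) * z) (γ * t) with h | h
  · have h1 : t ^ (r - 1) * ((C + 1) * z) ≤ t ^ (r - 1) * (γ * t) := by gcongr
    have : 0 ≤ (C + 1) * ((C + 1) / γ) ^ (r - 1) * (z ^ (r - 1) * z) := by positivity
    linarith
  · have h1 : t ≤ (C + 1) / γ * z := by
      rw [div_mul_eq_mul_div, le_div_iff₀ hγ]; linarith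
    have h2 := Real.rpow_le_rpow ht h1 (by linarith : 0 ≤ r - 1)
    rw [Real.mul_rpow (by positivity) hz] at h2
    have h3 : (C + 1) * z * t ^ (r - 1) ≤
        (C + 1) * z * (((C + 1) / γ) ^ (r - 1) * z ^ (r - 1)) := by gcongr
    have : 0 ≤ γ * (t ^ (r - 1) * t) := by positivity
    linarith

end PQComparison

/-! ### Mollification and convergence in `L^s`. -/

namespace PQComparison

open Filter Topology ContinuousLinearMap
open scoped Convolution

section Lebesgue

variable {α : Type*} [MeasurableSpace α] {μ : Measure α}

/-- Jensen's inequality for powers. -/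
lemma lintegral_rpow_le_of_isProbabilityMeasure [IsProbabilityMeasure μ] {F : α → ℝ≥0∞}
    (hF : AEMeasurable F μ) {s : ℝ} (hs : 1 ≤ s) : (∫⁻ x, F x ∂μ) ^ s ≤ ∫⁻ x, F x ^ s ∂μ := by
  have h := eLpNorm'_le_eLpNorm'_of_exponent_le (f := F) (p := 1) one_pos hs μ hF.aestronglyMeasurable
  simp only [eLpNorm', enorm_eq_self, ENNReal.rpow_one, div_one] at h
  have h2 := ENNReal.rpow_le_rpow h (zero_le_one.trans hs)
  rwa [← ENNReal.rpow_mul, one_div_mul_cancel (by linarith), ENNReal.rpow_one] at h2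

/-- Almost everywhere convergence together with a bound of the norms by the norm of the limit gives
convergence in mean of order `s`. -/
lemma tendsto_lintegral_rpow_sub {E : Type*} [NormedAddCommGroup E] {s : ℝ} (hs : 1 ≤ s)
    {f : ℕ → α → E} {g : α → E} (hf : ∀ j, AEStronglyMeasurable (f j) μ)
    (hg : AEStronglyMeasurable g μ) (hI : ∫⁻ x, ‖g x‖ₑ ^ s ∂μ ≠ ∞)
    (hle : ∀ j, ∫⁻ x, ‖f j x‖ₑ ^ s ∂μ ≤ ∫⁻ x, ‖g x‖ₑ ^ s ∂μ)
    (hlim : ∀ᵐ x ∂μ, Tendsto (fun j => f j x) atTop (𝓝 (g x))) :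
    Tendsto (fun j => ∫⁻ x, ‖f j x - g x‖ₑ ^ s ∂μ) atTop (𝓝 0) := by
  have hs0 : 0 < s := by linarith
  set I := ∫⁻ x, ‖g x‖ₑ ^ s ∂μ with hIdef
  set c : ℝ≥0∞ := 2 ^ (s - 1) with hc
  have hcfin : c ≠ ∞ := ENNReal.rpow_ne_top_of_nonneg (by linarith) (by norm_num)
  have hpt : ∀ j x, ‖f j x - g x‖ₑ ^ s ≤ c * (‖f j x‖ₑ ^ s + ‖g x‖ₑ ^ s) := fun j x =>
    (ENNReal.rpow_le_rpow enorm_sub_le hs0.le).trans (ENNReal.rpow_add_le_mul_rpow_add_rpow _ _ hs)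
  have hmf : ∀ j, AEMeasurable (fun x => ‖f j x‖ₑ ^ s) μ := fun j => (hf j).enorm.pow_const s
  have hmg : AEMeasurable (fun x => ‖g x‖ₑ ^ s) μ := hg.enorm.pow_const s
  have hmd : ∀ j, AEMeasurable (fun x => ‖f j x - g x‖ₑ ^ s) μ := fun j =>
    ((hf j).sub hg).enorm.pow_const s
  have htot : ∀ j, ∫⁻ x, c * (‖f j x‖ₑ ^ s + ‖g x‖ₑ ^ s) ∂μ ≤ c * (I + I) := by
    intro j
    rw [lintegral_const_mul' _ _ hcfin, lintegral_add_left' (hmf j)]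
    gcongr
    exact hle j
  have hdle : ∀ j, ∫⁻ x, ‖f j x - g x‖ₑ ^ s ∂μ ≤ c * (I + I) := fun j =>
    (lintegral_mono (hpt j)).trans (htot j)
  have hfin : c * (I + I) ≠ ∞ := ENNReal.mul_ne_top hcfin (by simp [hI])
  -- Fatou's lemma for the non-negative functions `c (|f_j|^s + |g|^s) - |f_j - g|^s`, whose
  -- pointwise limit is `2c|g|^s`.
  have hfatou : c * (I + I) ≤
      liminf (fun j => c * (I + I) - ∫⁻ x, ‖f j x - g x‖ₑ ^ s ∂μ) atTop := by
    calc c * (I + I) = ∫⁻ x, c * (‖g x‖ₑ ^ s + ‖g x‖ₑ ^ s) ∂μ := by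
          rw [lintegral_const_mul' _ _ hcfin, lintegral_add_left' hmg]
      _ = ∫⁻ x, liminf (fun j => c * (‖f j x‖ₑ ^ s + ‖g x‖ₑ ^ s) - ‖f j x - g x‖ₑ ^ s) atTop ∂μ := by
          refine lintegral_congr_ae ?_
          filter_upwards [hlim] with x hx
          have h1 : Tendsto (fun j => ‖f j x‖ₑ ^ s) atTop (𝓝 (‖g x‖ₑ ^ s)) :=
            (ENNReal.continuous_rpow_const.tendsto _).comp hx.enorm
          have h2 : Tendsto (fun j => ‖f j x - g x‖ₑ ^ s) atTop (𝓝 0) := by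
            have := (ENNReal.continuous_rpow_const (y := s)).tendsto 0
            rw [ENNReal.zero_rpow_of_pos hs0] at this
            refine this.comp ?_
            simpa using (hx.sub_const (g x)).enorm
          have h3 : Tendsto (fun j => c * (‖f j x‖ₑ ^ s + ‖g x‖ₑ ^ s)) atTop
              (𝓝 (c * (‖g x‖ₑ ^ s + ‖g x‖ₑ ^ s))) :=
            ENNReal.Tendsto.const_mul (h1.add_const _) (Or.inr hcfin)
          have h4 := ENNReal.Tendsto.sub h3 h2 (Or.inr (by simp))
          rw [tsub_zero] at h4
          exact h4.liminf_eq.symm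
      _ ≤ liminf (fun j => ∫⁻ x, (c * (‖f j x‖ₑ ^ s + ‖g x‖ₑ ^ s) - ‖f j x - g x‖ₑ ^ s) ∂μ) atTop :=
          lintegral_liminf_le' fun j => (((hmf j).add hmg).const_mul c).sub (hmd j)
      _ ≤ _ := by
          refine liminf_le_liminf (Eventually.of_forall fun j => ?_)
          rw [lintegral_sub' (hmd j) ((hdle j).trans_lt hfin.lt_top).ne
            (Eventually.of_forall (hpt j))]
          gcongr
          exact htot j
  rw [ENNReal.tendsto_nhds_zero]
  intro ε hε
  rcases eq_or_ne (c * (I + I)) 0 with h0 | h0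
  · exact Eventually.of_forall fun j => ((hdle j).trans h0.le).trans zero_le
  have hlt : c * (I + I) - ε < c * (I + I) := ENNReal.sub_lt_self hfin h0 hε.ne'
  filter_upwards [eventually_lt_of_lt_liminf (hlt.trans_le hfatou)] with j hj
  exact (lt_of_tsub_lt_tsub_left hj).le

end Lebesgue

variable {n : ℕ}

/-- A sequence of bump functions shrinking to the origin. -/
noncomputable def mollifier (n j : ℕ) : ContDiffBump (0 : Rn n) where
  rIn := 1 / (j + 1)
  rOut := 2 / (j + 1)
  rIn_pos := by positivity
  rIn_lt_rOut := by gcongr; norm_num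

lemma tendsto_mollifier_rOut : Tendsto (fun j => (mollifier n j).rOut) atTop (𝓝 0) := by
  have := (tendsto_one_div_add_atTop_nhds_zero_nat (𝕜 := ℝ)).const_mul 2
  simpa [mollifier, div_eq_mul_inv] using this

variable {E : Type*} [NormedAddCommGroup E] [NormedSpace ℝ E]

/-- The regularization of a function by convolution with a mollifier. -/
noncomputable def mollify (j : ℕ) (f : Rn n → E) : Rn n → E :=
  (mollifier n j).normed volume ⋆[lsmul ℝ ℝ, volume] f

lemma mollify_apply (j : ℕ) (f : Rn n → E) (x : Rn n) :
    mollify j f x = ∫ y, (mollifier n j).normed volume y • f (x - y) := rfl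

lemma mollify_eq_swap (j : ℕ) (f : Rn n → E) (x : Rn n) :
    mollify j f x = ∫ y, (mollifier n j).normed volume (x - y) • f y :=
  convolution_eq_swap _

lemma contDiff_mollify (j : ℕ) {f : Rn n → E} (hf : LocallyIntegrable f) :
    ContDiff ℝ (⊤ : ℕ∞) (mollify j f) :=
  (mollifier n j).hasCompactSupport_normed.contDiff_convolution_left _
    (mollifier n j).contDiff_normed hf

/-- Lebesgue differentiation. It applies because the ratio of the outer to the inner radius of the
bumps stays equal to `2`. -/
lemma ae_tendsto_mollify [CompleteSpace E] {f : Rn n → E} (hf : LocallyIntegrable f) :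
    ∀ᵐ x, Tendsto (fun j => mollify j f x) atTop (𝓝 (f x)) :=
  ContDiffBump.ae_convolution_tendsto_right_of_locallyIntegrable (K := 2) tendsto_mollifier_rOut
    (Eventually.of_forall fun j => le_of_eq (by simp [mollifier]; ring)) hf

/-- Makes a mollification an average, so that Jensen's inequality applies to it. -/
lemma isProbabilityMeasure_mollifier (j : ℕ) :
    IsProbabilityMeasure ((volume : Measure (Rn n)).withDensity
      fun y => ENNReal.ofReal ((mollifier n j).normed volume y)) := by
  constructor
  rw [withDensity_apply _ MeasurableSet.univ, Measure.restrict_univ,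
    ← ofReal_integral_eq_lintegral_ofReal (mollifier n j).integrable_normed
      (Eventually.of_forall (mollifier n j).nonneg_normed), (mollifier n j).integral_normed,
    ENNReal.ofReal_one]

lemma measurable_ofReal_mollifier (j : ℕ) :
    Measurable fun y => ENNReal.ofReal ((mollifier n j).normed volume y) :=
  (mollifier n j).continuous_normed.measurable.ennreal_ofReal

lemma enorm_mollify_le (j : ℕ) (f : Rn n → E) (x : Rn n) :
    ‖mollify j f x‖ₑ ≤
      ∫⁻ y, ENNReal.ofReal ((mollifier n j).normed volume y) * ‖f (x - y)‖ₑ := by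
  rw [mollify_apply]
  refine (enorm_integral_le_lintegral_enorm _).trans_eq (lintegral_congr fun y => ?_)
  rw [enorm_smul, Real.enorm_of_nonneg ((mollifier n j).nonneg_normed y)]

/-- Mollification does not increase the `L^s` norm. -/
lemma lintegral_mollify_rpow_le (j : ℕ) {s : ℝ} (hs : 1 ≤ s) {f : Rn n → E}
    (hf : AEStronglyMeasurable f) :
    ∫⁻ x, ‖mollify j f x‖ₑ ^ s ≤ ∫⁻ x, ‖f x‖ₑ ^ s := by
  set ρ : Rn n → ℝ≥0∞ := fun y => ENNReal.ofReal ((mollifier n j).normed volume y) with hρ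
  have hρm : Measurable ρ := measurable_ofReal_mollifier j
  have hprob := isProbabilityMeasure_mollifier (n := n) j
  have hshift : ∀ x : Rn n, AEMeasurable (fun y => ‖f (x - y)‖ₑ) := fun x =>
    (hf.comp_measurePreserving (Measure.measurePreserving_sub_left volume x)).enorm
  have hmeas2 : AEMeasurable (fun z : Rn n × Rn n => ρ z.2 * ‖f (z.1 - z.2)‖ₑ ^ s)
      (volume.prod volume) := by
    refine (hρm.comp measurable_snd).aemeasurable.mul (AEMeasurable.pow_const ?_ s)
    exact (hf.comp_quasiMeasurePreserving
      (quasiMeasurePreserving_sub_of_right_invariant volume volume)).enorm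
  calc ∫⁻ x, ‖mollify j f x‖ₑ ^ s ≤ ∫⁻ x, ∫⁻ y, ρ y * ‖f (x - y)‖ₑ ^ s := by
        refine lintegral_mono fun x => ?_
        have h1 := lintegral_rpow_le_of_isProbabilityMeasure
          (μ := volume.withDensity ρ) (F := fun y => ‖f (x - y)‖ₑ)
          ((hshift x).mono_ac (withDensity_absolutelyContinuous _ _)) hs
        rw [lintegral_withDensity_eq_lintegral_mul₀ hρm.aemeasurable (hshift x),
          lintegral_withDensity_eq_lintegral_mul₀ hρm.aemeasurable ((hshift x).pow_const s)] at h1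
        exact (ENNReal.rpow_le_rpow (enorm_mollify_le j f x) (by linarith)).trans h1
    _ = ∫⁻ y, ∫⁻ x, ρ y * ‖f (x - y)‖ₑ ^ s := lintegral_lintegral_swap hmeas2
    _ = ∫⁻ y, ρ y * ∫⁻ x, ‖f x‖ₑ ^ s := by
        refine lintegral_congr fun y => ?_
        rw [lintegral_const_mul' _ _ ENNReal.ofReal_ne_top,
          lintegral_sub_right_eq_self (fun x => ‖f x‖ₑ ^ s) y]
    _ = ∫⁻ x, ‖f x‖ₑ ^ s := by
        rw [lintegral_mul_const _ hρm]
        have : ∫⁻ y, ρ y = 1 := by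
          have := hprob.measure_univ
          rwa [withDensity_apply _ MeasurableSet.univ, Measure.restrict_univ] at this
        rw [this, one_mul]

/-- Mollifications converge almost everywhere and their norms do not exceed that of the limit, which
is enough for `tendsto_lintegral_rpow_sub`. -/
lemma tendsto_lintegral_mollify_sub [CompleteSpace E] {s : ℝ} (hs : 1 ≤ s) {f : Rn n → E}
    (hf : LocallyIntegrable f) (hI : ∫⁻ x, ‖f x‖ₑ ^ s ≠ ∞) :
    Tendsto (fun j => ∫⁻ x, ‖mollify j f x - f x‖ₑ ^ s) atTop (𝓝 0) :=
  tendsto_lintegral_rpow_sub hs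
    (fun j => (contDiff_mollify j hf).continuous.aestronglyMeasurable) hf.aestronglyMeasurable hI
    (fun j => lintegral_mollify_rpow_le j hs hf.aestronglyMeasurable) (ae_tendsto_mollify hf)

lemma norm_mollify_le (j : ℕ) {f : Rn n → E} {C : ℝ} (hf : ∀ᵐ x, ‖f x‖ ≤ C)
    (x : Rn n) : ‖mollify j f x‖ ≤ C := by
  rw [mollify_eq_swap]
  have hC : Integrable (fun y => (mollifier n j).normed volume (x - y) * C) :=
    ((mollifier n j).integrable_normed.comp_sub_left x).mul_const C
  refine (norm_integral_le_of_norm_le hC ?_).trans_eq ?_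
  · filter_upwards [hf] with y hy
    rw [norm_smul, Real.norm_of_nonneg ((mollifier n j).nonneg_normed _)]
    exact mul_le_mul_of_nonneg_left hy ((mollifier n j).nonneg_normed _)
  · rw [integral_mul_const, integral_sub_left_eq_self, (mollifier n j).integral_normed, one_mul]

lemma mollify_nonneg (j : ℕ) {f : Rn n → ℝ} (hf : ∀ x, 0 ≤ f x) (x : Rn n) :
    0 ≤ mollify j f x :=
  integral_nonneg fun y => mul_nonneg ((mollifier n j).nonneg_normed y) (hf _)

lemma mollify_eq_zero {j : ℕ} {f : Rn n → E} {K : Set (Rn n)} (hf : ∀ x ∉ K, f x = 0)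
    {x : Rn n} (hx : x ∉ Metric.cthickening (mollifier n j).rOut K) : mollify j f x = 0 := by
  rw [mollify_apply]
  refine integral_eq_zero_of_ae (Eventually.of_forall fun y => ?_)
  by_cases hy : x - y ∈ K
  · have : (mollifier n j).normed volume y = 0 := by
      rw [← Function.notMem_support, (mollifier n j).support_normed_eq]
      intro hy'
      refine hx (Metric.mem_cthickening_of_dist_le x (x - y) _ _ hy ?_)
      rw [dist_eq_norm, sub_sub_cancel]
      exact (mem_ball_zero_iff.1 hy').le
    simp [this]
  · simp [hf _ hy]

lemma tsupport_mollify_subset {j : ℕ} {f : Rn n → E} {K : Set (Rn n)} (hf : ∀ x ∉ K, f x = 0) :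
    tsupport (mollify j f) ⊆ Metric.cthickening (mollifier n j).rOut K :=
  closure_minimal (fun _ hx => by_contra fun h => hx (mollify_eq_zero hf h))
    Metric.isClosed_cthickening

end PQComparison

/-! ### Weak gradients on the whole space and the chain rule. -/

namespace PQComparison

open Filter Topology ContinuousLinearMap
open scoped Convolution

variable {n : ℕ}

/-- `Dz` satisfies the integration by parts formula for `z` on the whole space. -/
def IsGlobalWeakGradient (z : Rn n → ℝ) (Dz : Rn n → Rn n) : Prop :=
  ∀ φ : Rn n → ℝ, ContDiff ℝ (⊤ : ℕ∞) φ → HasCompactSupport φ →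
    ∫ x, z x • gradient φ x = -∫ x, φ x • Dz x

section Gradient

variable {φ : Rn n → ℝ}

lemma continuous_gradient (hφ : ContDiff ℝ 1 φ) : Continuous (gradient φ) :=
  (InnerProductSpace.toDual ℝ (Rn n)).symm.continuous.comp (hφ.continuous_fderiv one_ne_zero)

lemma support_gradient_subset : Function.support (gradient φ) ⊆ Function.support (fderiv ℝ φ) := by
  intro x hx h
  exact hx (by simp [gradient, h])

lemma hasCompactSupport_gradient (hφ : HasCompactSupport φ) : HasCompactSupport (gradient φ) :=
  (hφ.fderiv ℝ).mono support_gradient_subset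

lemma inner_gradient (φ : Rn n → ℝ) (x e : Rn n) : inner ℝ (gradient φ x) e = fderiv ℝ φ x e := by
  simp [gradient]

lemma exists_norm_gradient_le (hφ : ContDiff ℝ 1 φ) (hc : HasCompactSupport φ) :
    ∃ B : ℝ, 0 ≤ B ∧ ∀ x, ‖gradient φ x‖ ≤ B := by
  obtain ⟨B, hB⟩ := (hasCompactSupport_gradient hc).exists_bound_of_continuous
    (continuous_gradient hφ)
  exact ⟨B, (norm_nonneg _).trans (hB 0), hB⟩

lemma inner_integral_left {f : Rn n → Rn n} (hf : Integrable f) (e : Rn n) :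
    inner ℝ (∫ x, f x) e = ∫ x, inner ℝ (f x) e := by
  rw [real_inner_comm, ← integral_inner hf]
  simp_rw [real_inner_comm]

/-- Integration by parts for a `C¹` function against a compactly supported one. -/
lemma integral_smul_gradient_eq_neg {f : Rn n → ℝ} (hf : ContDiff ℝ 1 f) (hφ : ContDiff ℝ 1 φ)
    (hc : HasCompactSupport φ) : ∫ x, f x • gradient φ x = -∫ x, φ x • gradient f x := by
  have i1 : Integrable fun x => f x • gradient φ x :=
    (hf.continuous.smul (continuous_gradient hφ)).integrable_of_hasCompactSupport
      (hasCompactSupport_gradient hc).smul_left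
  have i2 : Integrable fun x => φ x • gradient f x :=
    (hφ.continuous.smul (continuous_gradient hf)).integrable_of_hasCompactSupport hc.smul_right
  refine ext_inner_right ℝ fun e => ?_
  rw [inner_neg_left, inner_integral_left i1, inner_integral_left i2]
  simp_rw [real_inner_smul_left, inner_gradient]
  have j1 : Integrable fun x => fderiv ℝ f x e * φ x := by
    have := i2.inner_const (𝕜 := ℝ) e
    simpa only [real_inner_smul_left, inner_gradient, mul_comm] using this
  have j2 : Integrable fun x => f x * fderiv ℝ φ x e := by
    have := i1.inner_const (𝕜 := ℝ) e
    simpa only [real_inner_smul_left, inner_gradient] using this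
  rw [integral_mul_fderiv_eq_neg_fderiv_mul_of_integrable j1 j2
    ((hf.continuous.mul hφ.continuous).integrable_of_hasCompactSupport hc.mul_left)
    (fun x _ => (hf.differentiable one_ne_zero) x) (fun x _ => (hφ.differentiable one_ne_zero) x)]
  simp_rw [mul_comm]

end Gradient

section Mollification

variable {z : Rn n → ℝ} {Dz : Rn n → Rn n}

/-- The gradient of the mollification is the mollification of the weak gradient. -/
lemma IsGlobalWeakGradient.hasGradientAt_mollify (h : IsGlobalWeakGradient z Dz)
    (hz : LocallyIntegrable z) (hD : LocallyIntegrable Dz) (j : ℕ) (x : Rn n) :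
    HasGradientAt (mollify j z) (mollify j Dz x) x := by
  set ρ : Rn n → ℝ := (mollifier n j).normed volume with hρ
  have hρs : ContDiff ℝ (⊤ : ℕ∞) ρ := (mollifier n j).contDiff_normed
  have hρ1 : ContDiff ℝ 1 ρ := hρs.of_le (by exact_mod_cast le_top)
  have hρc : HasCompactSupport ρ := (mollifier n j).hasCompactSupport_normed
  have hflip : mollify j z = z ⋆[(lsmul ℝ ℝ).flip, volume] ρ := (convolution_flip _).symm
  have hder := hρc.hasFDerivAt_convolution_right (lsmul ℝ ℝ : ℝ →L[ℝ] ℝ →L[ℝ] ℝ).flip hz hρ1 x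
  rw [← hflip] at hder
  rw [hasGradientAt_iff_hasFDerivAt]
  suffices hh : InnerProductSpace.toDual ℝ (Rn n) (mollify j Dz x) =
      (z ⋆[precompR (Rn n) (lsmul ℝ ℝ : ℝ →L[ℝ] ℝ →L[ℝ] ℝ).flip, volume] fderiv ℝ ρ) x by
    rw [hh]
    exact hder
  refine ContinuousLinearMap.ext fun e => ?_
  -- The reflected, translated kernel is itself a test function for the weak gradient. The sign from
  -- differentiating in `t` cancels the sign in the integration by parts.
  set φ : Rn n → ℝ := fun t => ρ (x - t) with hφ
  have hφs : ContDiff ℝ (⊤ : ℕ∞) φ := hρs.comp (contDiff_const.sub contDiff_id)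
  have hφc : HasCompactSupport φ :=
    hρc.comp_homeomorph (Homeomorph.subLeft x)
  have hφ1 : ContDiff ℝ 1 φ := hφs.of_le (by exact_mod_cast le_top)
  have hφd : ∀ t, fderiv ℝ φ t e = -fderiv ℝ ρ (x - t) e := by
    intro t
    have h1 : HasFDerivAt ρ (fderiv ℝ ρ (x - t)) (x - t) :=
      (hρ1.differentiable one_ne_zero _).hasFDerivAt
    have h2 := h1.comp t ((hasFDerivAt_id t).const_sub x)
    rw [show φ = ρ ∘ fun t => x - t from rfl]
    have h3 := h2.fderiv
    rw [h3]
    simp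
  have i1 : Integrable fun t => z t • gradient φ t :=
    hz.integrable_smul_right_of_hasCompactSupport (continuous_gradient hφ1)
      (hasCompactSupport_gradient hφc)
  have i2 : Integrable fun t => φ t • Dz t :=
    hD.integrable_smul_left_of_hasCompactSupport hφ1.continuous hφc
  have hw := congrArg (fun y => inner ℝ y e) (h φ hφs hφc)
  simp only [inner_neg_left] at hw
  rw [inner_integral_left i1] at hw
  simp_rw [real_inner_smul_left, inner_gradient, hφd] at hw
  rw [convolution_precompR_apply _ hz (hρc.fderiv ℝ) (hρ1.continuous_fderiv one_ne_zero),
    InnerProductSpace.toDual_apply_apply, mollify_eq_swap, convolution_def]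
  simp only [mul_neg, integral_neg, neg_inj] at hw
  rw [← hw]
  refine integral_congr_ae (Eventually.of_forall fun t => ?_)
  simp [mul_comm]

lemma IsGlobalWeakGradient.gradient_mollify (h : IsGlobalWeakGradient z Dz)
    (hz : LocallyIntegrable z) (hD : LocallyIntegrable Dz) (j : ℕ) :
    gradient (mollify j z) = mollify j Dz :=
  funext fun x => (h.hasGradientAt_mollify hz hD j x).gradient

end Mollification

section ChainRule

variable {z : Rn n → ℝ} {Dz : Rn n → Rn n}

/-- The classical chain rule for the smooth function `mollify j z`, integrated by parts; the limit
in `j` is taken in `integral_comp`. -/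
lemma IsGlobalWeakGradient.comp_aux (h : IsGlobalWeakGradient z Dz) (hz : Integrable z)
    (hD : Integrable Dz) {G g : ℝ → ℝ} (hG : ∀ s, HasDerivAt G (g s) s) (hg : Continuous g)
    (j : ℕ) {φ : Rn n → ℝ} (hφ : ContDiff ℝ 1 φ) (hc : HasCompactSupport φ) :
    ∫ x, G (mollify j z x) • gradient φ x =
      -∫ x, φ x • (g (mollify j z x) • mollify j Dz x) := by
  have hzj : ContDiff ℝ 1 (mollify j z) :=
    (contDiff_mollify j hz.locallyIntegrable).of_le (by exact_mod_cast le_top)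
  have hG1 : ContDiff ℝ 1 G := by
    rw [contDiff_one_iff_deriv]
    exact ⟨fun s => (hG s).differentiableAt, by rwa [funext fun s => (hG s).deriv]⟩
  have hgrad : ∀ x, gradient (fun x => G (mollify j z x)) x =
      g (mollify j z x) • mollify j Dz x := by
    intro x
    have h1 := (h.hasGradientAt_mollify hz.locallyIntegrable hD.locallyIntegrable j x).hasFDerivAt
    have h2 := (hG (mollify j z x)).comp_hasFDerivAt x h1
    refine HasGradientAt.gradient ?_
    rw [hasGradientAt_iff_hasFDerivAt, map_smul]
    exact h2
  refine (integral_smul_gradient_eq_neg (hG1.comp hzj) hφ hc).trans ?_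
  simp_rw [← hgrad]
  rfl

/-- The chain rule for weak gradients, for outer functions with bounded continuous derivative. -/
lemma IsGlobalWeakGradient.integral_comp (h : IsGlobalWeakGradient z Dz) (hz : Integrable z)
    (hD : Integrable Dz) {G g : ℝ → ℝ} (hG : ∀ s, HasDerivAt G (g s) s) (hg : Continuous g)
    (hb : ∀ s, |g s| ≤ 1) {φ : Rn n → ℝ} (hφ : ContDiff ℝ 1 φ) (hc : HasCompactSupport φ) :
    ∫ x, G (z x) • gradient φ x = -∫ x, φ x • (g (z x) • Dz x) := by
  have hzl := hz.locallyIntegrable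
  have hDl := hD.locallyIntegrable
  have hzc : ∀ j, Continuous (mollify j z) := fun j => (contDiff_mollify j hzl).continuous
  have hDc : ∀ j, Continuous (mollify j Dz) := fun j => (contDiff_mollify j hDl).continuous
  have hlip : LipschitzWith 1 G := by
    refine lipschitzWith_of_nnnorm_deriv_le (fun s => (hG s).differentiableAt) fun s => ?_
    rw [(hG s).deriv, ← NNReal.coe_le_coe]
    simpa using hb s
  have hGc : Continuous G := hlip.continuous
  have hLz : Tendsto (fun j => ∫⁻ x, ‖mollify j z x - z x‖ₑ) atTop (𝓝 0) := by
    have := tendsto_lintegral_mollify_sub le_rfl hzl (by simpa using hz.2.ne)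
    simpa using this
  have hLD : Tendsto (fun j => ∫⁻ x, ‖mollify j Dz x - Dz x‖ₑ) atTop (𝓝 0) := by
    have := tendsto_lintegral_mollify_sub le_rfl hDl (by simpa using hD.2.ne)
    simpa using this
  obtain ⟨B, hB0, hB⟩ := exists_norm_gradient_le hφ hc
  obtain ⟨B', hB'⟩ := hc.exists_bound_of_continuous hφ.continuous
  have hgradc := continuous_gradient hφ
  have hgradi : Integrable (gradient φ) :=
    hgradc.integrable_of_hasCompactSupport (hasCompactSupport_gradient hc)
  -- the left-hand side
  have lim1 : Tendsto (fun j => ∫ x, G (mollify j z x) • gradient φ x) atTop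
      (𝓝 (∫ x, G (z x) • gradient φ x)) := by
    refine tendsto_integral_of_L1 _ ?_ (Eventually.of_forall fun j => ?_) ?_
    · exact (hGc.comp_aestronglyMeasurable hz.1).smul hgradc.aestronglyMeasurable
    · exact ((hGc.comp (hzc j)).smul hgradc).integrable_of_hasCompactSupport
        (hasCompactSupport_gradient hc).smul_left
    · have h0 : Tendsto (fun j => ENNReal.ofReal B * ∫⁻ x, ‖mollify j z x - z x‖ₑ) atTop
          (𝓝 0) := by
        simpa using ENNReal.Tendsto.const_mul hLz (Or.inr ENNReal.ofReal_ne_top)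
      refine tendsto_of_tendsto_of_tendsto_of_le_of_le tendsto_const_nhds h0
        (fun _ => zero_le) fun j => ?_
      simp only
      rw [← lintegral_const_mul' _ _ ENNReal.ofReal_ne_top]
      refine lintegral_mono fun x => ?_
      rw [← sub_smul, enorm_smul, mul_comm]
      refine mul_le_mul' ?_ ?_
      · rw [← ofReal_norm]; exact ENNReal.ofReal_le_ofReal (hB x)
      · have := hlip.edist_le_mul (mollify j z x) (z x)
        simpa [edist_eq_enorm_sub] using this
  -- the right-hand side
  have lim2 : Tendsto (fun j => ∫ x, φ x • (g (mollify j z x) • (mollify j Dz x - Dz x))) atTop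
      (𝓝 0) := by
    have hmul : ∀ j x, ‖φ x • (g (mollify j z x) • (mollify j Dz x - Dz x))‖ₑ ≤
        ENNReal.ofReal B' * ‖mollify j Dz x - Dz x‖ₑ := by
      intro j x
      rw [enorm_smul, enorm_smul]
      refine mul_le_mul' ?_ ?_
      · rw [← ofReal_norm]; exact ENNReal.ofReal_le_ofReal (hB' x)
      · refine mul_le_of_le_one_left' ?_
        rw [← ofReal_norm, ENNReal.ofReal_le_one]
        exact hb _
    have h0 : Tendsto (fun j => ENNReal.ofReal B' * ∫⁻ x, ‖mollify j Dz x - Dz x‖ₑ) atTop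
        (𝓝 0) := by
      simpa using ENNReal.Tendsto.const_mul hLD (Or.inr ENNReal.ofReal_ne_top)
    rw [tendsto_zero_iff_enorm_tendsto_zero]
    refine tendsto_of_tendsto_of_tendsto_of_le_of_le tendsto_const_nhds h0
        (fun _ => zero_le) fun j => ?_
    refine (enorm_integral_le_lintegral_enorm _).trans ?_
    rw [← lintegral_const_mul' _ _ ENNReal.ofReal_ne_top]
    exact lintegral_mono (hmul j)
  have hdom : ∀ (ψ : Rn n → ℝ), AEStronglyMeasurable ψ →
      AEStronglyMeasurable (fun x => φ x • (g (ψ x) • Dz x)) := fun ψ hψ =>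
    hφ.continuous.aestronglyMeasurable.smul ((hg.comp_aestronglyMeasurable hψ).smul hD.1)
  have hbd : ∀ (ψ : Rn n → ℝ) x, ‖φ x • (g (ψ x) • Dz x)‖ ≤ B' * ‖Dz x‖ := by
    intro ψ x
    rw [norm_smul, norm_smul]
    have h1 := hB' x
    have h2 : ‖g (ψ x)‖ * ‖Dz x‖ ≤ 1 * ‖Dz x‖ := by gcongr; exact hb _
    rw [one_mul] at h2
    exact mul_le_mul h1 h2 (by positivity) ((norm_nonneg _).trans h1)
  have lim3 : Tendsto (fun j => ∫ x, φ x • (g (mollify j z x) • Dz x)) atTop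
      (𝓝 (∫ x, φ x • (g (z x) • Dz x))) := by
    refine tendsto_integral_of_dominated_convergence (fun x => B' * ‖Dz x‖)
      (fun j => hdom _ (hzc j).aestronglyMeasurable) (hD.norm.const_mul B')
      (fun j => Eventually.of_forall (hbd _)) ?_
    filter_upwards [ae_tendsto_mollify hzl] with x hx
    exact (((hg.tendsto _).comp hx).smul_const _).const_smul _
  -- Both factors vary with `j`. The error in the gradient is small in `L¹` because `g` is bounded,
  -- and the remaining integrals, with `Dz` fixed, converge by domination.
  have hsum : ∀ j, ∫ x, φ x • (g (mollify j z x) • mollify j Dz x) =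
      (∫ x, φ x • (g (mollify j z x) • (mollify j Dz x - Dz x))) +
        ∫ x, φ x • (g (mollify j z x) • Dz x) := by
    intro j
    have j1 : Integrable fun x => φ x • (g (mollify j z x) • mollify j Dz x) :=
      (hφ.continuous.smul ((hg.comp (hzc j)).smul (hDc j))).integrable_of_hasCompactSupport
        hc.smul_right
    have j2 : Integrable fun x => φ x • (g (mollify j z x) • Dz x) :=
      (hD.norm.const_mul B').mono' (hdom _ (hzc j).aestronglyMeasurable)
        (Eventually.of_forall (hbd _))
    rw [← integral_add _ j2]
    · simp_rw [smul_sub, sub_add_cancel]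
    · simp only [smul_sub]
      exact j1.sub j2
  have lim4 := lim2.add lim3
  rw [zero_add] at lim4
  refine tendsto_nhds_unique lim1 ?_
  simp_rw [h.comp_aux hz hD hG hg _ hφ hc, hsum]
  exact lim4.neg

/-- The chain rule for weak gradients, for primitives of bounded pointwise limits of continuous
functions. -/
lemma IsGlobalWeakGradient.integral_primitive (h : IsGlobalWeakGradient z Dz) (hz : Integrable z)
    (hD : Integrable Dz) {g : ℕ → ℝ → ℝ} {g' : ℝ → ℝ} (hg : ∀ i, Continuous (g i))
    (hb : ∀ i s, |g i s| ≤ 1) (hlim : ∀ s, Tendsto (fun i => g i s) atTop (𝓝 (g' s))) (k : ℝ)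
    {φ : Rn n → ℝ} (hφ : ContDiff ℝ 1 φ) (hc : HasCompactSupport φ) :
    ∫ x, (∫ t in k..z x, g' t) • gradient φ x = -∫ x, φ x • (g' (z x) • Dz x) := by
  have hi : ∀ i, ∫ x, (∫ t in k..z x, g i t) • gradient φ x = -∫ x, φ x • (g i (z x) • Dz x) :=
    fun i => h.integral_comp hz hD (G := fun s => ∫ t in k..s, g i t)
      (fun s => (hg i).integral_hasStrictDerivAt k s |>.hasDerivAt) (hg i) (hb i) hφ hc
  obtain ⟨B, hB0, hB⟩ := exists_norm_gradient_le hφ hc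
  obtain ⟨B', hB'⟩ := hc.exists_bound_of_continuous hφ.continuous
  have hgradc := continuous_gradient hφ
  have hgradi : Integrable (gradient φ) :=
    hgradc.integrable_of_hasCompactSupport (hasCompactSupport_gradient hc)
  have hprim : ∀ i, Continuous fun s => ∫ t in k..s, g i t := fun i =>
    intervalIntegral.continuous_primitive (fun a b => (hg i).intervalIntegrable a b) k
  have lim1 : Tendsto (fun i => ∫ x, (∫ t in k..z x, g i t) • gradient φ x) atTop
      (𝓝 (∫ x, (∫ t in k..z x, g' t) • gradient φ x)) := by
    refine tendsto_integral_of_dominated_convergence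
      (fun x => B * ‖z x‖ + |k| * ‖gradient φ x‖)
      (fun i => ((hprim i).comp_aestronglyMeasurable hz.1).smul hgradc.aestronglyMeasurable)
      ((hz.norm.const_mul B).add (hgradi.norm.const_mul |k|))
      (fun i => Eventually.of_forall fun x => ?_) (Eventually.of_forall fun x => ?_)
    · have h1 : ‖∫ t in k..z x, g i t‖ ≤ 1 * |z x - k| :=
        intervalIntegral.norm_integral_le_of_norm_le_const fun t _ => hb i t
      have h2 : |z x - k| ≤ |z x| + |k| := abs_sub _ _
      rw [norm_smul]
      have h3 := mul_le_mul_of_nonneg_right (h1.trans (by linarith : _ ≤ |z x| + |k|))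
        (norm_nonneg (gradient φ x))
      have h4 := mul_le_mul_of_nonneg_left (hB x) (abs_nonneg (z x))
      rw [Real.norm_eq_abs (z x)]
      linarith
    · refine Tendsto.smul_const ?_ _
      refine intervalIntegral.tendsto_integral_filter_of_dominated_convergence (fun _ => 1)
        (Eventually.of_forall fun i => (hg i).aestronglyMeasurable)
        (Eventually.of_forall fun i => Eventually.of_forall fun t _ => hb i t)
        intervalIntegrable_const (Eventually.of_forall fun t _ => hlim t)
  have lim2 : Tendsto (fun i => ∫ x, φ x • (g i (z x) • Dz x)) atTop
      (𝓝 (∫ x, φ x • (g' (z x) • Dz x))) := by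
    refine tendsto_integral_of_dominated_convergence (fun x => B' * ‖Dz x‖)
      (fun i => hφ.continuous.aestronglyMeasurable.smul
        (((hg i).comp_aestronglyMeasurable hz.1).smul hD.1)) (hD.norm.const_mul B')
      (fun i => Eventually.of_forall fun x => ?_) (Eventually.of_forall fun x => ?_)
    · rw [norm_smul, norm_smul]
      have h1 := hB' x
      have h2 : ‖g i (z x)‖ * ‖Dz x‖ ≤ 1 * ‖Dz x‖ := by gcongr; exact hb _ _
      rw [one_mul] at h2
      exact mul_le_mul h1 h2 (by positivity) ((norm_nonneg _).trans h1)
    · exact ((hlim (z x)).smul_const _).const_smul _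
  refine tendsto_nhds_unique lim1 ?_
  simp_rw [hi]
  exact lim2.neg

end ChainRule

end PQComparison

/-! ### Sobolev functions supported in a compact set, and their truncations. -/

namespace PQComparison

open Filter Topology ContinuousLinearMap

variable {n : ℕ}

/-- Functions of `W^{1,s}(ℝⁿ)`, with their weak gradient, that vanish off the set `K`. -/
structure MemW1Supported (s : ℝ≥0∞) (K : Set (Rn n)) (z : Rn n → ℝ) (Dz : Rn n → Rn n) :
    Prop where
  memLp : MemLp z s
  memLp_grad : MemLp Dz s
  eq_zero : ∀ x ∉ K, z x = 0
  grad_eq_zero : ∀ x ∉ K, Dz x = 0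
  isWeakGradient : IsGlobalWeakGradient z Dz

namespace MemW1Supported

variable {s : ℝ≥0∞} {K : Set (Rn n)} {z : Rn n → ℝ} {Dz : Rn n → Rn n}

lemma mono_exponent (h : MemW1Supported s K z Dz) (hK : IsCompact K) {s' : ℝ≥0∞} (hs : s' ≤ s) :
    MemW1Supported s' K z Dz where
  memLp := h.memLp.mono_exponent_of_measure_support_ne_top h.eq_zero hK.measure_lt_top.ne hs
  memLp_grad := h.memLp_grad.mono_exponent_of_measure_support_ne_top h.grad_eq_zero
    hK.measure_lt_top.ne hs
  eq_zero := h.eq_zero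
  grad_eq_zero := h.grad_eq_zero
  isWeakGradient := h.isWeakGradient

lemma integrable (h : MemW1Supported s K z Dz) (hK : IsCompact K) (hs : 1 ≤ s) : Integrable z :=
  memLp_one_iff_integrable.1 (h.mono_exponent hK hs).memLp

lemma integrable_grad (h : MemW1Supported s K z Dz) (hK : IsCompact K) (hs : 1 ≤ s) :
    Integrable Dz :=
  memLp_one_iff_integrable.1 (h.mono_exponent hK hs).memLp_grad

end MemW1Supported

section PositivePart

/-- Ramps starting at `k` have the indicator of the open half-line as limit, which yields
truncations; ramps already equal to `1` at `k` (`tendsto_clamp_Ici`) yield the closed half-line,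
which detects the gradient on a level set. -/
lemma tendsto_clamp_Ioi (k s : ℝ) :
    Tendsto (fun i : ℕ => max 0 (min 1 ((i : ℝ) * (s - k)))) atTop (𝓝 (if k < s then 1 else 0)) := by
  split_ifs with h
  · have : Tendsto (fun i : ℕ => (i : ℝ) * (s - k)) atTop atTop :=
      tendsto_natCast_atTop_atTop.atTop_mul_const (sub_pos.2 h)
    refine tendsto_const_nhds.congr' ?_
    filter_upwards [this.eventually_ge_atTop 1] with i hi
    rw [min_eq_left hi, max_eq_right zero_le_one]
  · refine tendsto_const_nhds.congr fun i => ?_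
    have : (i : ℝ) * (s - k) ≤ 0 := mul_nonpos_of_nonneg_of_nonpos (by positivity) (by linarith)
    rw [max_eq_left ((min_le_right _ _).trans this)]

lemma tendsto_clamp_Ici (k s : ℝ) :
    Tendsto (fun i : ℕ => max 0 (min 1 (1 + (i : ℝ) * (s - k)))) atTop
      (𝓝 (if k ≤ s then 1 else 0)) := by
  split_ifs with h
  · refine tendsto_const_nhds.congr fun i => ?_
    have : 0 ≤ (i : ℝ) * (s - k) := mul_nonneg (by positivity) (by linarith)
    rw [min_eq_left (by linarith), max_eq_right zero_le_one]
  · have : Tendsto (fun i : ℕ => (i : ℝ) * (s - k)) atTop atBot :=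
      tendsto_natCast_atTop_atTop.atTop_mul_const_of_neg (by linarith)
    refine tendsto_const_nhds.congr' ?_
    filter_upwards [this.eventually_le_atBot (-1)] with i hi
    rw [max_eq_left ((min_le_right _ _).trans (by linarith))]

lemma abs_clamp_le (y : ℝ) : |max 0 (min 1 y)| ≤ 1 := by
  rw [abs_of_nonneg (le_max_left _ _)]
  exact max_le zero_le_one (min_le_left _ _)

lemma integral_ite_lt (k s : ℝ) : ∫ t in k..s, (if k < t then (1 : ℝ) else 0) = max (s - k) 0 := by
  rcases le_total k s with h | h
  · rw [intervalIntegral.integral_of_le h,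
      setIntegral_congr_fun (g := fun _ => (1 : ℝ)) measurableSet_Ioc
        fun t ht => by simp [ht.1]]
    simp [h]
  · rw [intervalIntegral.integral_of_ge h,
      setIntegral_congr_fun (g := fun _ => (0 : ℝ)) measurableSet_Ioc
        fun t ht => by simp [not_lt.2 ht.2]]
    simp [h]

lemma integral_ite_le {k s : ℝ} (h : s ≤ k) : ∫ t in k..s, (if k ≤ t then (1 : ℝ) else 0) = 0 := by
  rw [intervalIntegral.integral_of_ge h, integral_Ioc_eq_integral_Ioo,
      setIntegral_congr_fun (g := fun _ => (0 : ℝ)) measurableSet_Ioo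
        fun t ht => by simp [ht.2]]
  simp

variable {s : ℝ≥0∞} {K : Set (Rn n)} {z : Rn n → ℝ} {Dz : Rn n → Rn n}

/-- Truncation from below at a positive level. -/
lemma MemW1Supported.posPart (h : MemW1Supported s K z Dz) (hK : IsCompact K) (hs : 1 ≤ s) {k : ℝ}
    (hk : 0 < k) :
    MemW1Supported s K (fun x => max (z x - k) 0) ({x | k < z x}.indicator Dz) where
  memLp := by
    refine h.memLp.mono ((h.memLp.1.sub aestronglyMeasurable_const).sup aestronglyMeasurable_const)
      (Eventually.of_forall fun x => ?_)
    simp only [Real.norm_eq_abs]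
    rw [abs_of_nonneg (le_max_right _ _)]
    exact max_le (by linarith [le_abs_self (z x)]) (abs_nonneg _)
  memLp_grad := by
    refine h.memLp_grad.mono (h.memLp_grad.1.indicator₀
      (nullMeasurableSet_lt aemeasurable_const h.memLp.1.aemeasurable))
      (Eventually.of_forall fun x => norm_indicator_le_norm_self _ _)
  eq_zero x hx := by simp [h.eq_zero x hx, hk.le]
  grad_eq_zero x hx := by simp [indicator, h.grad_eq_zero x hx]
  isWeakGradient φ hφ hc := by
    have := h.isWeakGradient.integral_primitive (h.integrable hK hs) (h.integrable_grad hK hs)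
      (g := fun i s => max 0 (min 1 ((i : ℝ) * (s - k)))) (fun i => by fun_prop)
      (fun i s => abs_clamp_le _) (tendsto_clamp_Ioi k) k
      (hφ.of_le (by exact_mod_cast le_top)) hc
    simp only [integral_ite_lt] at this
    rw [this]
    congr 1
    refine integral_congr_ae (Eventually.of_forall fun x => ?_)
    by_cases hx : k < z x <;> simp [indicator, hx]

/-- The weak gradient vanishes where the function attains its essential maximum. -/
lemma MemW1Supported.ae_grad_eq_zero_of_eq (h : MemW1Supported s K z Dz) (hK : IsCompact K)
    (hs : 1 ≤ s) {m : ℝ} (hm : ∀ᵐ x, z x ≤ m) : ∀ᵐ x, z x = m → Dz x = 0 := by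
  have hz := h.integrable hK hs
  have hD := h.integrable_grad hK hs
  have hmeas : NullMeasurableSet {x | m ≤ z x} :=
    nullMeasurableSet_le aemeasurable_const h.memLp.1.aemeasurable
  have hint : Integrable ({x | m ≤ z x}.indicator Dz) :=
    hD.mono (hD.1.indicator₀ hmeas)
      (Eventually.of_forall fun x => norm_indicator_le_norm_self _ _)
  have h0 := ae_eq_zero_of_integral_contDiff_smul_eq_zero hint.locallyIntegrable
    fun φ hφ hc => ?_
  · filter_upwards [h0] with x hx hxm
    simpa [indicator, hxm] using hx
  · have := h.isWeakGradient.integral_primitive hz hD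
      (g := fun i s => max 0 (min 1 (1 + (i : ℝ) * (s - m)))) (fun i => by fun_prop)
      (fun i s => abs_clamp_le _) (tendsto_clamp_Ici m) m
      (hφ.of_le (by exact_mod_cast le_top)) hc
    -- Below the maximum `m` the primitive based at `m` is identically `0`, so the chain rule says
    -- that `Dz` restricted to `{m ≤ z}` is the weak gradient of `0`.
    have hl : ∫ x, (∫ t in m..z x, if m ≤ t then (1 : ℝ) else 0) • gradient φ x = 0 := by
      refine integral_eq_zero_of_ae ?_
      filter_upwards [hm] with x hx
      simp [integral_ite_le hx]
    rw [hl, eq_comm, neg_eq_zero] at this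
    rw [← this]
    refine integral_congr_ae (Eventually.of_forall fun x => ?_)
    by_cases hx : m ≤ z x <;> simp [indicator, hx]

end PositivePart

/-! ### Translation estimates and Poincaré inequalities. -/

section Translation

/-- The fundamental theorem of calculus along the segment from `x` to `x + h`, Jensen's inequality
in the segment parameter, then Tonelli and translation invariance. -/
lemma lintegral_translate_sub_rpow_le_of_contDiff {r : ℝ} (hr : 1 ≤ r) {f : Rn n → ℝ}
    (hf : ContDiff ℝ 1 f) (h : Rn n) :
    ∫⁻ x, ‖f (x + h) - f x‖ₑ ^ r ≤ ‖h‖ₑ ^ r * ∫⁻ x, ‖gradient f x‖ₑ ^ r := by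
  have hr0 : 0 ≤ r := by linarith
  have hgc := continuous_gradient hf
  have hprob : IsProbabilityMeasure ((volume : Measure ℝ).restrict (Ioc 0 1)) := ⟨by simp⟩
  have hcomp : ∀ x : Rn n, Continuous fun t : ℝ => gradient f (x + t • h) := fun x =>
    hgc.comp (by fun_prop)
  have hpt : ∀ x, ‖f (x + h) - f x‖ₑ ^ r ≤
      ‖h‖ₑ ^ r * ∫⁻ t in Ioc (0 : ℝ) 1, ‖gradient f (x + t • h)‖ₑ ^ r := by
    intro x
    have hder : ∀ t : ℝ, HasDerivAt (fun t : ℝ => f (x + t • h))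
        (inner ℝ (gradient f (x + t • h)) h) t := by
      intro t
      rw [inner_gradient]
      have h1 : HasDerivAt (fun t : ℝ => x + t • h) h t := by
        simpa using ((hasDerivAt_id t).smul_const h).const_add x
      exact ((hf.differentiable one_ne_zero _).hasFDerivAt).comp_hasDerivAt t h1
    have hftc := intervalIntegral.integral_eq_sub_of_hasDerivAt (a := 0) (b := 1)
      (fun t _ => hder t) (((hcomp x).inner continuous_const).intervalIntegrable 0 1)
    simp only [one_smul, zero_smul, add_zero] at hftc
    rw [← hftc, intervalIntegral.integral_of_le zero_le_one]
    have hm : AEMeasurable (fun t : ℝ => ‖gradient f (x + t • h)‖ₑ)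
        ((volume : Measure ℝ).restrict (Ioc 0 1)) := (hcomp x).enorm.measurable.aemeasurable
    calc _ ≤ (∫⁻ t in Ioc (0 : ℝ) 1, ‖h‖ₑ * ‖gradient f (x + t • h)‖ₑ) ^ r := by
          refine ENNReal.rpow_le_rpow ((enorm_integral_le_lintegral_enorm _).trans ?_) hr0
          refine lintegral_mono fun t => ?_
          rw [mul_comm, ← ofReal_norm, ← ofReal_norm, ← ofReal_norm,
            ← ENNReal.ofReal_mul (norm_nonneg _)]
          exact ENNReal.ofReal_le_ofReal (norm_inner_le_norm _ _)
      _ ≤ _ := by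
          rw [lintegral_const_mul' _ _ (by simp), ENNReal.mul_rpow_of_nonneg _ _ hr0]
          gcongr
          exact lintegral_rpow_le_of_isProbabilityMeasure hm hr
  have hmeas : Measurable fun w : Rn n × ℝ => ‖gradient f (w.1 + w.2 • h)‖ₑ ^ r :=
    ((hgc.comp (by fun_prop)).enorm.measurable).pow_const r
  calc ∫⁻ x, ‖f (x + h) - f x‖ₑ ^ r
      ≤ ∫⁻ x, ‖h‖ₑ ^ r * ∫⁻ t in Ioc (0 : ℝ) 1, ‖gradient f (x + t • h)‖ₑ ^ r := lintegral_mono hpt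
    _ = ‖h‖ₑ ^ r * ∫⁻ x, ∫⁻ t in Ioc (0 : ℝ) 1, ‖gradient f (x + t • h)‖ₑ ^ r :=
        lintegral_const_mul' _ _ (ENNReal.rpow_ne_top_of_nonneg hr0 (by simp))
    _ = ‖h‖ₑ ^ r * ∫⁻ t in Ioc (0 : ℝ) 1, ∫⁻ x, ‖gradient f (x + t • h)‖ₑ ^ r := by
        rw [lintegral_lintegral_swap hmeas.aemeasurable]
    _ = ‖h‖ₑ ^ r * ∫⁻ x, ‖gradient f x‖ₑ ^ r := by
        congr 1
        have : ∀ t : ℝ, ∫⁻ x, ‖gradient f (x + t • h)‖ₑ ^ r = ∫⁻ x, ‖gradient f x‖ₑ ^ r := fun t =>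
          lintegral_add_right_eq_self (fun x => ‖gradient f x‖ₑ ^ r) (t • h)
        simp [this]

variable {s : ℝ≥0∞} {K : Set (Rn n)} {z : Rn n → ℝ} {Dz : Rn n → Rn n}

/-- The smooth case passes to the limit by Fatou's lemma on the left, while mollification does not
increase the norm of the gradient on the right. -/
lemma MemW1Supported.lintegral_translate_sub_rpow_le (hz : MemW1Supported s K z Dz)
    (hK : IsCompact K) (hs : 1 ≤ s) {r : ℝ} (hr : 1 ≤ r) (h : Rn n) :
    ∫⁻ x, ‖z (x + h) - z x‖ₑ ^ r ≤ ‖h‖ₑ ^ r * ∫⁻ x, ‖Dz x‖ₑ ^ r := by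
  have hzl := (hz.integrable hK hs).locallyIntegrable
  have hDl := (hz.integrable_grad hK hs).locallyIntegrable
  have hsm : ∀ j, ContDiff ℝ 1 (mollify j z) := fun j =>
    (contDiff_mollify j hzl).of_le (by exact_mod_cast le_top)
  have hae := ae_tendsto_mollify hzl
  have hae' : ∀ᵐ x, Tendsto (fun j => mollify j z (x + h)) atTop (𝓝 (z (x + h))) :=
    (measurePreserving_add_right volume h).quasiMeasurePreserving.ae hae
  calc ∫⁻ x, ‖z (x + h) - z x‖ₑ ^ r
      = ∫⁻ x, liminf (fun j => ‖mollify j z (x + h) - mollify j z x‖ₑ ^ r) atTop := by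
        refine lintegral_congr_ae ?_
        filter_upwards [hae, hae'] with x hx hx'
        exact ((ENNReal.continuous_rpow_const.tendsto _).comp (hx'.sub hx).enorm).liminf_eq.symm
    _ ≤ liminf (fun j => ∫⁻ x, ‖mollify j z (x + h) - mollify j z x‖ₑ ^ r) atTop := by
        refine lintegral_liminf_le' fun j => ?_
        have hc := (hsm j).continuous
        exact (((hc.comp (continuous_add_const h)).sub hc).enorm.measurable.pow_const r).aemeasurable
    _ ≤ liminf (fun _ : ℕ => ‖h‖ₑ ^ r * ∫⁻ x, ‖Dz x‖ₑ ^ r) atTop := by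
        refine liminf_le_liminf (Eventually.of_forall fun j => ?_)
        refine (lintegral_translate_sub_rpow_le_of_contDiff hr (hsm j) h).trans ?_
        rw [hz.isWeakGradient.gradient_mollify hzl hDl]
        exact mul_le_mul_right (lintegral_mollify_rpow_le j hr hDl.aestronglyMeasurable) _
    _ = _ := liminf_const _

/-- The Poincaré inequality for functions supported in a fixed compact set. -/
lemma exists_poincare (hn : 1 ≤ n) (hK : IsCompact K) {r : ℝ} (hr : 1 ≤ r) :
    ∃ P : ℝ≥0∞, P ≠ ∞ ∧ ∀ (s : ℝ≥0∞) (z : Rn n → ℝ) (Dz : Rn n → Rn n), 1 ≤ s →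
      MemW1Supported s K z Dz → ∫⁻ x, ‖z x‖ₑ ^ r ≤ P * ∫⁻ x, ‖Dz x‖ₑ ^ r := by
  obtain ⟨R, hR0, hR⟩ := hK.isBounded.subset_closedBall_lt 0 0
  -- The shift is longer than the diameter of a ball containing `K`, so `x` and `x + h` are never
  -- both in `K` and the translation difference at `x ∈ K` is `-z x`.
  set h : Rn n := EuclideanSpace.single ⟨0, hn⟩ (2 * R + 1) with hh
  have hnorm : ‖h‖ = 2 * R + 1 := by
    rw [hh, PiLp.norm_single, Real.norm_of_nonneg (by linarith)]
  refine ⟨‖h‖ₑ ^ r, ENNReal.rpow_ne_top_of_nonneg (by linarith) (by simp),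
    fun s z Dz hs hz => le_trans (lintegral_mono fun x => ?_)
      (hz.lintegral_translate_sub_rpow_le hK hs hr h)⟩
  by_cases hx : x ∈ K
  · have : x + h ∉ K := by
      intro hx'
      have h1 := mem_closedBall_zero_iff.1 (hR hx)
      have h2 := mem_closedBall_zero_iff.1 (hR hx')
      have h3 := norm_sub_le (x + h) x
      rw [add_sub_cancel_left, hnorm] at h3
      linarith
    simp [hz.eq_zero _ this]
  · simp [hz.eq_zero _ hx, ENNReal.zero_rpow_of_pos (by linarith : 0 < r)]

/-- On sets of small measure, the constant in the Poincaré inequality is small. -/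
lemma exists_poincare_small (hn : 1 ≤ n) (hK : IsCompact K) {r : ℝ} (hr : 1 ≤ r) {η : ℝ≥0∞}
    (hη : 0 < η) :
    ∃ δ : ℝ≥0∞, 0 < δ ∧ ∀ (s : ℝ≥0∞) (z : Rn n → ℝ) (Dz : Rn n → Rn n), 1 ≤ s →
      MemW1Supported s K z Dz → ∀ A : Set (Rn n), volume A ≤ δ →
        ∫⁻ x in A, ‖z x‖ₑ ^ r ≤ η * ∫⁻ x, ‖Dz x‖ₑ ^ r := by
  obtain ⟨P, hP, hPoin⟩ := exists_poincare hn hK hr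
  have hr0 : 0 < r := by linarith
  set c : ℝ≥0∞ := 2 ^ (r - 1) with hc
  have hcfin : c ≠ ∞ := ENNReal.rpow_ne_top_of_nonneg (by linarith) (by norm_num)
  have hη2 : 0 < η / 2 := ENNReal.half_pos hη.ne'
  have hseq : Tendsto (fun j : ℕ => ENNReal.ofReal (1 / ((j : ℝ) + 1))) atTop (𝓝 0) := by
    simpa using ENNReal.tendsto_ofReal (tendsto_one_div_add_atTop_nhds_zero_nat (𝕜 := ℝ))
  -- First the radius of the averaging ball is fixed to make the translation error small; only then,
  -- with the volume of the ball known, is the bound on the measure of `A` chosen.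
  obtain ⟨i, hi⟩ : ∃ i : ℕ, c * ENNReal.ofReal (1 / ((i : ℝ) + 1)) ^ r ≤ η / 2 := by
    have h1 : Tendsto (fun j : ℕ => c * ENNReal.ofReal (1 / ((j : ℝ) + 1)) ^ r) atTop (𝓝 0) := by
      have h2 := (ENNReal.continuous_rpow_const (y := r)).tendsto 0
      rw [ENNReal.zero_rpow_of_pos hr0] at h2
      simpa using ENNReal.Tendsto.const_mul (h2.comp hseq) (Or.inr hcfin)
    exact (h1.eventually_le_const hη2).exists
  set ε : ℝ := 1 / ((i : ℝ) + 1) with hε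
  have hε0 : 0 < ε := by positivity
  set B : Set (Rn n) := Metric.ball 0 ε with hB
  have hB0 : volume B ≠ 0 := (Metric.measure_ball_pos volume 0 hε0).ne'
  have hBfin : volume B ≠ ∞ := measure_ball_lt_top.ne
  obtain ⟨j, hj⟩ : ∃ j : ℕ,
      c * ((volume B)⁻¹ * P) * ENNReal.ofReal (1 / ((j : ℝ) + 1)) ≤ η / 2 := by
    have h1 : Tendsto (fun j : ℕ => c * ((volume B)⁻¹ * P) * ENNReal.ofReal (1 / ((j : ℝ) + 1)))
        atTop (𝓝 0) := by
      simpa using ENNReal.Tendsto.const_mul hseq (Or.inr (ENNReal.mul_ne_top hcfin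
        (ENNReal.mul_ne_top (ENNReal.inv_ne_top.2 hB0) hP)))
    exact (h1.eventually_le_const hη2).exists
  refine ⟨ENNReal.ofReal (1 / ((j : ℝ) + 1)), ENNReal.ofReal_pos.2 (by positivity),
    fun s z Dz hs hz A hA => ?_⟩
  set D := ∫⁻ x, ‖Dz x‖ₑ ^ r with hD
  have hzm := hz.memLp.1
  have hzmeas : AEMeasurable fun x => ‖z x‖ₑ ^ r := hzm.enorm.pow_const r
  have hshift : ∀ h : Rn n, AEMeasurable fun x => ‖z (x + h)‖ₑ ^ r := fun h =>
    hzmeas.comp_quasiMeasurePreserving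
      (measurePreserving_add_right volume h).quasiMeasurePreserving
  -- Compare `z x` with `z (x + h)` and average over `h ∈ B`. For each `x`, the average of the
  -- shifted term is at most `‖z‖_r^r / |B|`, so integrating over `A` gains the factor `|A|`. This
  -- replaces the higher integrability of the Sobolev embedding.
  have hpt : ∀ h ∈ B, ∫⁻ x in A, ‖z x‖ₑ ^ r ≤
      c * (ENNReal.ofReal ε ^ r * D + ∫⁻ x in A, ‖z (x + h)‖ₑ ^ r) := by
    intro h hh
    calc ∫⁻ x in A, ‖z x‖ₑ ^ r
        ≤ ∫⁻ x in A, c * (‖z (x + h) - z x‖ₑ ^ r + ‖z (x + h)‖ₑ ^ r) := by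
          refine lintegral_mono fun x => ?_
          refine le_trans (ENNReal.rpow_le_rpow ?_ hr0.le)
            (ENNReal.rpow_add_le_mul_rpow_add_rpow _ _ hr)
          have := enorm_sub_le (a := z (x + h)) (b := z (x + h) - z x)
          rw [sub_sub_cancel, add_comm] at this
          exact this
      _ = c * ((∫⁻ x in A, ‖z (x + h) - z x‖ₑ ^ r) + ∫⁻ x in A, ‖z (x + h)‖ₑ ^ r) := by
          rw [lintegral_const_mul' _ _ hcfin, lintegral_add_right' _ (hshift h).restrict]
      _ ≤ _ := by
          gcongr
          refine (setLIntegral_le_lintegral _ _).trans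
            ((hz.lintegral_translate_sub_rpow_le hK hs hr h).trans ?_)
          gcongr
          rw [← ofReal_norm]
          exact ENNReal.ofReal_le_ofReal (mem_ball_zero_iff.1 hh).le
  have hmeas2 : AEMeasurable (fun w : Rn n × Rn n => ‖z (w.2 + w.1)‖ₑ ^ r)
      ((volume.restrict B).prod (volume.restrict A)) := by
    have h1 : AEMeasurable (fun w : Rn n × Rn n => ‖z (w.2 + w.1)‖ₑ ^ r)
        (volume.prod volume) := by
      refine AEMeasurable.comp_quasiMeasurePreserving (g := fun y => ‖z y‖ₑ ^ r)
        (f := fun w : Rn n × Rn n => w.2 + w.1) hzmeas ?_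
      simp_rw [add_comm]
      exact Measure.quasiMeasurePreserving_snd.comp
        (measurePreserving_prod_add volume volume).quasiMeasurePreserving
    rw [Measure.prod_restrict]
    exact h1.restrict
  have hdouble : ∫⁻ h in B, ∫⁻ x in A, ‖z (x + h)‖ₑ ^ r ≤ volume A * (P * D) := by
    rw [lintegral_lintegral_swap hmeas2]
    calc ∫⁻ x in A, ∫⁻ h in B, ‖z (x + h)‖ₑ ^ r ≤ ∫⁻ _ in A, P * D := by
          refine lintegral_mono fun x => (setLIntegral_le_lintegral _ _).trans ?_
          rw [lintegral_add_left_eq_self (fun y => ‖z y‖ₑ ^ r) x]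
          exact hPoin s z Dz hs hz
      _ = volume A * (P * D) := by rw [setLIntegral_const, mul_comm]
  have havg : volume B * ∫⁻ x in A, ‖z x‖ₑ ^ r ≤
      c * (volume B * (ENNReal.ofReal ε ^ r * D) + volume A * (P * D)) := by
    calc volume B * ∫⁻ x in A, ‖z x‖ₑ ^ r = ∫⁻ _ in B, ∫⁻ x in A, ‖z x‖ₑ ^ r := by
          rw [setLIntegral_const, mul_comm]
      _ ≤ ∫⁻ h in B, c * (ENNReal.ofReal ε ^ r * D + ∫⁻ x in A, ‖z (x + h)‖ₑ ^ r) :=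
          setLIntegral_mono' measurableSet_ball hpt
      _ = c * (volume B * (ENNReal.ofReal ε ^ r * D) +
            ∫⁻ h in B, ∫⁻ x in A, ‖z (x + h)‖ₑ ^ r) := by
          rw [lintegral_const_mul' _ _ hcfin, lintegral_add_left' aemeasurable_const,
            setLIntegral_const, mul_comm (volume B)]
      _ ≤ _ := by gcongr
  calc ∫⁻ x in A, ‖z x‖ₑ ^ r = (volume B)⁻¹ * (volume B * ∫⁻ x in A, ‖z x‖ₑ ^ r) := by
        rw [← mul_assoc, ENNReal.inv_mul_cancel hB0 hBfin, one_mul]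
    _ ≤ (volume B)⁻¹ * (c * (volume B * (ENNReal.ofReal ε ^ r * D) + volume A * (P * D))) := by
        gcongr
    _ = ((volume B)⁻¹ * volume B) * (c * ENNReal.ofReal ε ^ r * D) +
          c * ((volume B)⁻¹ * P) * volume A * D := by ring
    _ ≤ 1 * (η / 2 * D) + η / 2 * D := by
        rw [ENNReal.inv_mul_cancel hB0 hBfin]
        gcongr
        exact le_trans (by gcongr) hj
    _ = η * D := by rw [one_mul, ← add_mul, ENNReal.add_halves]

end Translation

end PQComparison

/-! ### Levels near the essential supremum and the absorption argument. -/

namespace PQComparison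

open Filter Topology ContinuousLinearMap

variable {n : ℕ}

section Levels

variable {K : Set (Rn n)} {z : Rn n → ℝ} {Dz : Rn n → Rn n}

/-- Continuity of the measure from above; the sets have finite measure because `κ 0 > 0` forces them
into `K`. -/
lemma tendsto_measure_levels (hK : IsCompact K) (hz : AEMeasurable z) (hD : AEStronglyMeasurable Dz)
    (hzero : ∀ x ∉ K, z x = 0) {κ : ℕ → ℝ} (hmono : Monotone κ) (hpos : 0 < κ 0)
    (hnull : volume (⋂ j, {x | κ j < z x ∧ Dz x ≠ 0}) = 0) :
    Tendsto (fun j => volume {x | κ j < z x ∧ Dz x ≠ 0}) atTop (𝓝 0) := by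
  rw [← hnull]
  refine tendsto_measure_iInter_atTop (fun j => ?_) (fun i j hij x hx => ?_) ⟨0, ?_⟩
  · have h0 : NullMeasurableSet {x | Dz x = 0} :=
      hD.nullMeasurableSet_eq_fun aestronglyMeasurable_const
    exact (nullMeasurableSet_lt aemeasurable_const hz).inter h0.compl
  · exact ⟨(hmono hij).trans_lt hx.1, hx.2⟩
  · refine ((measure_mono fun x hx => ?_).trans_lt hK.measure_lt_top).ne
    by_contra hxK
    have := hx.1
    rw [hzero x hxK] at this
    linarith

/-- There are levels above `k₀`, close to the essential supremum, such that the part of the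
superlevel set where the gradient does not vanish is non-trivial but small. -/
lemma MemW1Supported.exists_level {s : ℝ≥0∞} (h : MemW1Supported s K z Dz) (hK : IsCompact K)
    (hs : 1 ≤ s) {k₀ δ : ℝ} (hk₀ : 0 < k₀) (hδ : 0 < δ) {ε : ℝ≥0∞} (hε : 0 < ε)
    (hne : ¬ ∀ᵐ x, z x ≤ k₀) :
    ∃ k ≥ k₀, (¬ ∀ᵐ x, z x ≤ k) ∧ ((∃ Λ : ℝ, ∀ᵐ x, z x ≤ Λ) → ∀ᵐ x, z x ≤ k + δ) ∧
      volume {x | k < z x ∧ Dz x ≠ 0} ≤ ε := by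
  have hzm := h.memLp.1.aemeasurable
  by_cases hbdd : ∃ Λ : ℝ, ∀ᵐ x, z x ≤ Λ
  · obtain ⟨Λ, hΛ⟩ := hbdd
    set S : Set ℝ := {k | ∀ᵐ x, z x ≤ k} with hS
    have hSne : S.Nonempty := ⟨Λ, hΛ⟩
    have hlow : ∀ k ∈ S, k₀ < k := by
      intro k hk
      by_contra hk'
      exact hne (Eventually.mono (show ∀ᵐ x, z x ≤ k from hk) fun x hx => hx.trans (not_lt.1 hk'))
    have hSbdd : BddBelow S := ⟨k₀, fun k hk => (hlow k hk).le⟩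
    set m := sInf S with hm
    have hmS : ∀ᵐ x, z x ≤ m := by
      have h1 : ∀ i : ℕ, ∀ᵐ x, z x ≤ m + 1 / ((i : ℝ) + 1) := by
        intro i
        obtain ⟨k, hk, hk'⟩ := exists_lt_of_csInf_lt hSne
          (show sInf S < m + 1 / ((i : ℝ) + 1) by
            have : (0 : ℝ) < 1 / ((i : ℝ) + 1) := by positivity
            linarith)
        exact Eventually.mono (show ∀ᵐ x, z x ≤ k from hk) fun x hx => hx.trans hk'.le
      filter_upwards [ae_all_iff.2 h1] with x hx
      refine ge_of_tendsto' (f := fun i : ℕ => m + 1 / ((i : ℝ) + 1)) (x := atTop) ?_ hx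
      simpa using (tendsto_one_div_add_atTop_nhds_zero_nat (𝕜 := ℝ)).const_add m
    have hk₀m : k₀ < m := hlow m hmS
    -- Levels increasing to the essential supremum `m`, never below `k₀` and within `δ` of `m`.
    set κ : ℕ → ℝ := fun j => max k₀ (m - δ / ((j : ℝ) + 1)) with hκ
    have hκm : ∀ j, κ j < m := fun j => max_lt hk₀m (by
      have : (0 : ℝ) < δ / ((j : ℝ) + 1) := by positivity
      linarith)
    have hκmono : Monotone κ := by
      intro i j hij
      refine max_le_max le_rfl (sub_le_sub_left ?_ _)
      gcongr
    have hκlim : Tendsto (fun j : ℕ => m - δ / ((j : ℝ) + 1)) atTop (𝓝 m) := by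
      have := ((tendsto_one_div_add_atTop_nhds_zero_nat (𝕜 := ℝ)).const_mul δ).const_sub m
      simpa [div_eq_mul_inv] using this
    -- A point in all these sets has `z x ≥ m`, hence almost surely `z x = m`, where the gradient
    -- vanishes almost everywhere.
    have hnull : volume (⋂ j, {x | κ j < z x ∧ Dz x ≠ 0}) = 0 := by
      have h1 : ∀ᵐ x, x ∉ ⋂ j, {x | κ j < z x ∧ Dz x ≠ 0} := by
        filter_upwards [hmS, h.ae_grad_eq_zero_of_eq hK hs hmS] with x hx hx' hmem
        rw [mem_iInter] at hmem
        have h2 : m ≤ z x := le_of_tendsto' hκlim fun j =>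
          (le_max_right _ _).trans (hmem j).1.le
        exact (hmem 0).2 (hx' (le_antisymm hx h2))
      exact measure_eq_zero_iff_ae_notMem.2 h1
    have hlim := tendsto_measure_levels hK hzm h.memLp_grad.1 h.eq_zero hκmono
      (hk₀.trans_le (le_max_left _ _)) hnull
    obtain ⟨j, hj⟩ := (hlim.eventually_le_const hε).exists
    refine ⟨κ j, le_max_left _ _, fun hj' => not_le.2 (hκm j) (csInf_le hSbdd hj'), fun _ => ?_, hj⟩
    filter_upwards [hmS] with x hx
    have h1 : m - δ / ((j : ℝ) + 1) ≤ κ j := le_max_right _ _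
    have h2 : δ / ((j : ℝ) + 1) ≤ δ := div_le_self hδ.le (by linarith [Nat.cast_nonneg (α := ℝ) j])
    linarith
  -- Without an upper bound the levels `k₀ + j` work, since every value of `z` is finite.
  · have hnull : volume (⋂ j : ℕ, {x | k₀ + (j : ℝ) < z x ∧ Dz x ≠ 0}) = 0 := by
      convert measure_empty (μ := (volume : Measure (Rn n)))
      refine eq_empty_of_forall_notMem fun x hx => ?_
      rw [mem_iInter] at hx
      obtain ⟨j, hj⟩ := exists_nat_ge (z x - k₀)
      have := (hx j).1
      linarith
    have hlim := tendsto_measure_levels hK hzm h.memLp_grad.1 h.eq_zero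
      (κ := fun j : ℕ => k₀ + (j : ℝ)) (fun i j hij => by simpa using hij) (by simpa using hk₀) hnull
    obtain ⟨j, hj⟩ := (hlim.eventually_le_const hε).exists
    exact ⟨k₀ + j, by simp, fun h' => hbdd ⟨_, h'⟩, fun h' => absurd h' hbdd, hj⟩

/-- Energy estimates on superlevel sets close to the essential supremum bound the function. -/
lemma MemW1Supported.ae_le_of_energy_le (hn : 1 ≤ n) (hK : IsCompact K) {r : ℝ} (hr : 1 ≤ r)
    (h : MemW1Supported (ENNReal.ofReal r) K z Dz) {k₀ δ : ℝ} (hk₀ : 0 < k₀) (hδ : 0 < δ)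
    {C : ℝ≥0∞} (hC : C ≠ ∞)
    (henergy : ∀ k ≥ k₀, ((∃ Λ : ℝ, ∀ᵐ x, z x ≤ Λ) → ∀ᵐ x, z x ≤ k + δ) →
      ∫⁻ x, ‖{x | k < z x}.indicator Dz x‖ₑ ^ r ≤
        C * ∫⁻ x in {x | k < z x ∧ Dz x ≠ 0}, ‖max (z x - k) 0‖ₑ ^ r) :
    ∀ᵐ x, z x ≤ k₀ := by
  by_contra hne
  have hr0 : 0 < r := by linarith
  have hs : 1 ≤ ENNReal.ofReal r := by simpa using hr
  have hC1 : C + 1 ≠ ∞ := by simp [hC]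
  have hC0 : C + 1 ≠ 0 := by simp
  -- The Poincaré constant is chosen so that the energy estimate reads `D ≤ D / 2`; `C + 1` avoids
  -- division by zero.
  obtain ⟨ε, hε, hsmall⟩ := exists_poincare_small (K := K) hn hK hr
    (η := 2⁻¹ / (C + 1)) (ENNReal.div_pos (by simp) hC1)
  obtain ⟨k, hk, hkne, hkb, hkA⟩ := h.exists_level hK hs hk₀ hδ hε hne
  have hzk := h.posPart hK hs (hk₀.trans_le hk)
  set D := ∫⁻ x, ‖{x | k < z x}.indicator Dz x‖ₑ ^ r with hD
  have hDfin : D ≠ ∞ := by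
    have := (eLpNorm_lt_top_iff_lintegral_rpow_enorm_lt_top (by simpa using hr0)
      ENNReal.ofReal_ne_top).1 hzk.memLp_grad.2
    rw [ENNReal.toReal_ofReal hr0.le] at this
    exact this.ne
  have hle : D ≤ 2⁻¹ * D := by
    calc D ≤ C * ∫⁻ x in {x | k < z x ∧ Dz x ≠ 0}, ‖max (z x - k) 0‖ₑ ^ r := henergy k hk hkb
      _ ≤ (C + 1) * (2⁻¹ / (C + 1) * D) := by
          gcongr
          · exact le_self_add
          · exact hsmall _ _ _ hs hzk _ hkA
      _ = 2⁻¹ * D := by rw [← mul_assoc, ENNReal.mul_div_cancel hC0 hC1]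
  have hD0 : D = 0 := by
    by_contra hD0
    have : 2⁻¹ * D < 1 * D := (ENNReal.mul_lt_mul_iff_left hD0 hDfin).2 (by simp)
    rw [one_mul] at this
    exact absurd hle (not_le.2 this)
  obtain ⟨P, -, hP⟩ := exists_poincare hn hK hr
  have hz0 := hP _ _ _ hs hzk
  rw [← hD, hD0, mul_zero, nonpos_iff_eq_zero,
    lintegral_eq_zero_iff' (hzk.memLp.1.enorm.pow_const r)] at hz0
  refine hkne ?_
  filter_upwards [hz0] with x hx
  have h1 : max (z x - k) 0 = 0 := by
    simpa [ENNReal.rpow_eq_zero_iff_of_pos hr0] using hx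
  linarith [max_eq_right_iff.1 h1]

end Levels

/-! ### Sobolev functions as test functions. -/

section Duality

variable {F : Type*} [NormedAddCommGroup F] [InnerProductSpace ℝ F]

/-- `g` and `f` lie in spaces in duality: either `L^{p'}_loc` and `L^p` with `1 < p < ∞`, or
`L^1_loc` and `L^∞`. -/
def LocDual (Ω : Set (Rn n)) (g f : Rn n → F) : Prop :=
  (∃ p : ℝ, 1 < p ∧ LocMemLp Ω (ENNReal.ofReal (p / (p - 1))) g ∧ MemLp f (ENNReal.ofReal p)) ∨
    (LocMemLp Ω 1 g ∧ MemLp f ∞)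

lemma lintegral_enorm_inner_le {α : Type*} [MeasurableSpace α] {μ : Measure α} {p : ℝ} (hp : 1 < p)
    {g f : α → F} (hg : AEStronglyMeasurable g μ) (hf : AEStronglyMeasurable f μ) :
    ∫⁻ x, ‖inner ℝ (g x) (f x)‖ₑ ∂μ ≤
      (∫⁻ x, ‖g x‖ₑ ^ (p / (p - 1)) ∂μ) ^ (1 / (p / (p - 1))) *
        (∫⁻ x, ‖f x‖ₑ ^ p ∂μ) ^ (1 / p) := by
  refine le_trans (lintegral_mono fun x => ?_) (ENNReal.lintegral_mul_le_Lp_mul_Lq μ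
    (Real.HolderConjugate.conjExponent hp).symm hg.enorm hf.enorm)
  rw [← ofReal_norm, Pi.mul_apply, ← ofReal_norm, ← ofReal_norm,
    ← ENNReal.ofReal_mul (norm_nonneg _)]
  exact ENNReal.ofReal_le_ofReal (norm_inner_le_norm _ _)

lemma lintegral_rpow_ne_top_of_memLp {α G : Type*} [MeasurableSpace α] {μ : Measure α}
    [NormedAddCommGroup G] {p : ℝ} (hp : 0 < p) {f : α → G} (hf : MemLp f (ENNReal.ofReal p) μ) :
    ∫⁻ x, ‖f x‖ₑ ^ p ∂μ ≠ ∞ := by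
  have := (eLpNorm_lt_top_iff_lintegral_rpow_enorm_lt_top (by simpa using hp)
      ENNReal.ofReal_ne_top).1 hf.2
  rw [ENNReal.toReal_ofReal hp.le] at this
  exact this.ne

lemma setIntegral_inner_eq_of_subset {Ω K : Set (Rn n)} (hΩ : MeasurableSet Ω) (hKΩ : K ⊆ Ω)
    {g f : Rn n → F} (hf : ∀ x ∉ K, f x = 0) :
    ∫ x in Ω, inner ℝ (g x) (f x) = ∫ x in K, inner ℝ (g x) (f x) :=
  setIntegral_eq_of_subset_of_forall_sdiff_eq_zero hΩ hKΩ fun x hx => by simp [hf x hx.2]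

lemma ae_norm_le_of_memLp_top {α G : Type*} [MeasurableSpace α] {μ : Measure α}
    [NormedAddCommGroup G] {f : α → G} (hf : MemLp f ∞ μ) :
    ∃ C : ℝ, 0 ≤ C ∧ ∀ᵐ x ∂μ, ‖f x‖ ≤ C := by
  refine ⟨(eLpNorm f ∞ μ).toReal, ENNReal.toReal_nonneg, ?_⟩
  have h : ∀ᵐ x ∂μ, ‖f x‖ₑ ≤ eLpNorm f ∞ μ := by
    rw [eLpNorm_exponent_top]; exact ae_le_eLpNormEssSup
  filter_upwards [h] with x hx
  rw [← toReal_enorm]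
  exact ENNReal.toReal_mono hf.2.ne hx

lemma LocDual.integrableOn {Ω K : Set (Rn n)} (hΩ : IsOpen Ω) (hK : IsCompact K) (hKΩ : K ⊆ Ω)
    {g f : Rn n → F} (h : LocDual Ω g f) (hf : ∀ x ∉ K, f x = 0) :
    IntegrableOn (fun x => inner ℝ (g x) (f x)) Ω := by
  have hI : IntegrableOn (fun x => inner ℝ (g x) (f x)) K := by
    rcases h with ⟨p, hp, hg, hfp⟩ | ⟨hg, hfp⟩
    · have hp0 : 0 < p := by linarith
      have hq0 : 0 < p / (p - 1) := div_pos hp0 (by linarith)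
      have hgK := hg K hKΩ hK
      have hfK := hfp.restrict K
      refine ⟨hgK.1.inner hfK.1, (lintegral_enorm_inner_le hp hgK.1 hfK.1).trans_lt ?_⟩
      refine ENNReal.mul_lt_top ?_ ?_ <;>
        refine ENNReal.rpow_lt_top_of_nonneg (by positivity) (lintegral_rpow_ne_top_of_memLp ?_ ?_)
      exacts [hq0, hgK, hp0, hfK]
    · have hgK := hg K hKΩ hK
      have hfK := hfp.restrict K
      obtain ⟨C, -, hC⟩ := ae_norm_le_of_memLp_top hfK
      refine ((memLp_one_iff_integrable.1 hgK).norm.mul_const C).mono' (hgK.1.inner hfK.1) ?_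
      filter_upwards [hC] with x hx
      exact (norm_inner_le_norm _ _).trans (mul_le_mul_of_nonneg_left hx (norm_nonneg _))
  exact hI.of_forall_sdiff_eq_zero hΩ.measurableSet fun x hx => by simp [hf x hx.2]

/-- Pairings against mollifications converge. -/
lemma LocDual.tendsto_integral_mollify [CompleteSpace F] {Ω K : Set (Rn n)} (hΩ : IsOpen Ω)
    (hK : IsCompact K) (hKΩ : K ⊆ Ω) {g f : Rn n → F} (h : LocDual Ω g f) (hf : ∀ x ∉ K, f x = 0)
    (hfi : Integrable f) :
    Tendsto (fun j => ∫ x in Ω, inner ℝ (g x) (mollify j f x)) atTop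
      (𝓝 (∫ x in Ω, inner ℝ (g x) (f x))) := by
  -- For small radii all mollifications live in one compact neighbourhood of `K` inside `Ω`, where
  -- the local integrability of `g` is available.
  obtain ⟨δ, hδ, hδΩ⟩ := hK.exists_cthickening_subset_open hΩ hKΩ
  set K' := Metric.cthickening δ K with hK'
  have hK'c : IsCompact K' := hK.cthickening
  have hKK' : K ⊆ K' := Metric.self_subset_cthickening K
  have hf' : ∀ x ∉ K', f x = 0 := fun x hx => hf x fun hx' => hx (hKK' hx')
  have hev : ∀ᶠ j in atTop, ∫ x in Ω, inner ℝ (g x) (mollify j f x) =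
      ∫ x in K', inner ℝ (g x) (mollify j f x) := by
    filter_upwards [tendsto_mollifier_rOut.eventually_le_const hδ] with j hj
    exact setIntegral_inner_eq_of_subset hΩ.measurableSet hδΩ fun x hx =>
      mollify_eq_zero hf fun hx' => hx (Metric.cthickening_mono hj K hx')
  rw [setIntegral_inner_eq_of_subset hΩ.measurableSet hδΩ hf', tendsto_congr' hev]
  have hcont : ∀ j, Continuous (mollify j f) := fun j =>
    (contDiff_mollify j hfi.locallyIntegrable).continuous
  rcases h with ⟨p, hp, hg, hfp⟩ | ⟨hg, hfp⟩
  · have hp0 : 0 < p := by linarith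
    have hq0 : 0 < p / (p - 1) := div_pos hp0 (by linarith)
    have hgK := hg K' hδΩ hK'c
    set A := (∫⁻ x in K', ‖g x‖ₑ ^ (p / (p - 1))) ^ (1 / (p / (p - 1))) with hA
    have hAfin : A ≠ ∞ := ENNReal.rpow_ne_top_of_nonneg (by positivity)
      (lintegral_rpow_ne_top_of_memLp hq0 hgK)
    have hfin := lintegral_rpow_ne_top_of_memLp hp0 hfp
    have hlim := tendsto_lintegral_mollify_sub hp.le hfi.locallyIntegrable hfin
    refine tendsto_integral_of_L1 _ (hgK.1.inner hfi.1.restrict)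
      (Eventually.of_forall fun j => ?_) ?_
    · refine ⟨hgK.1.inner (hcont j).aestronglyMeasurable,
        (lintegral_enorm_inner_le hp hgK.1 (hcont j).aestronglyMeasurable).trans_lt ?_⟩
      refine ENNReal.mul_lt_top hAfin.lt_top
        (ENNReal.rpow_lt_top_of_nonneg (by positivity) (ne_top_of_le_ne_top hfin ?_))
      exact (setLIntegral_le_lintegral _ _).trans (lintegral_mollify_rpow_le j hp.le hfi.1)
    · have h0 : Tendsto (fun j => A * (∫⁻ x, ‖mollify j f x - f x‖ₑ ^ p) ^ (1 / p)) atTop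
          (𝓝 0) := by
        have h1 := ((ENNReal.continuous_rpow_const (y := 1 / p)).tendsto 0).comp hlim
        rw [ENNReal.zero_rpow_of_pos (by positivity)] at h1
        simpa using ENNReal.Tendsto.const_mul h1 (Or.inr hAfin)
      refine tendsto_of_tendsto_of_tendsto_of_le_of_le tendsto_const_nhds h0
        (fun _ => zero_le) fun j => ?_
      simp_rw [← inner_sub_right]
      refine (lintegral_enorm_inner_le hp hgK.1
        ((hcont j).aestronglyMeasurable.sub hfi.1.restrict)).trans ?_
      refine mul_le_mul_right (ENNReal.rpow_le_rpow ?_ (by positivity)) _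
      exact setLIntegral_le_lintegral _ _
  · have hgK := hg K' hδΩ hK'c
    obtain ⟨C, -, hC⟩ := ae_norm_le_of_memLp_top hfp
    refine tendsto_integral_of_dominated_convergence (fun x => ‖g x‖ * C)
      (fun j => hgK.1.inner (hcont j).aestronglyMeasurable)
      ((memLp_one_iff_integrable.1 hgK).norm.mul_const C)
      (fun j => Eventually.of_forall fun x => (norm_inner_le_norm _ _).trans
        (mul_le_mul_of_nonneg_left (norm_mollify_le j hC x) (norm_nonneg _))) ?_
    filter_upwards [ae_restrict_of_ae (ae_tendsto_mollify hfi.locallyIntegrable)] with x hx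
    exact tendsto_const_nhds.inner hx

/-- A weak differential inequality tested with non-negative Sobolev functions. -/
lemma integral_inner_grad_le {Ω K : Set (Rn n)} (hΩ : IsOpen Ω) (hK : IsCompact K) (hKΩ : K ⊆ Ω)
    {s : ℝ≥0∞} (hs : 1 ≤ s) {z : Rn n → ℝ} {Dz : Rn n → Rn n} (hz : MemW1Supported s K z Dz)
    (hz0 : ∀ x, 0 ≤ z x) {g : Rn n → Rn n} {b : Rn n → ℝ}
    (hweak : ∀ φ : Rn n → ℝ, ContDiff ℝ 1 φ → HasCompactSupport φ → tsupport φ ⊆ Ω →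
      (∀ x, 0 ≤ φ x) → ∫ x in Ω, inner ℝ (g x) (gradient φ x) ≤ ∫ x in Ω, b x * φ x)
    (hg : LocDual Ω g Dz) (hb : LocDual Ω b z) :
    ∫ x in Ω, inner ℝ (g x) (Dz x) ≤ ∫ x in Ω, b x * z x := by
  have hzi := hz.integrable hK hs
  have hDi := hz.integrable_grad hK hs
  have h1 := hg.tendsto_integral_mollify hΩ hK hKΩ hz.grad_eq_zero hDi
  have h2 := hb.tendsto_integral_mollify hΩ hK hKΩ hz.eq_zero hzi
  simp only [RCLike.inner_apply, conj_trivial, mul_comm _ (b _)] at h2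
  obtain ⟨δ, hδ, hδΩ⟩ := hK.exists_cthickening_subset_open hΩ hKΩ
  refine le_of_tendsto_of_tendsto h1 h2 ?_
  filter_upwards [tendsto_mollifier_rOut.eventually_le_const hδ] with j hj
  have hsub := (tsupport_mollify_subset (j := j) hz.eq_zero).trans (Metric.cthickening_mono hj K)
  have := hweak (mollify j z)
    ((contDiff_mollify j hzi.locallyIntegrable).of_le (by exact_mod_cast le_top))
    (hK.cthickening.of_isClosed_subset (isClosed_tsupport _) hsub) (hsub.trans hδΩ)
    (mollify_nonneg j hz0)
  rwa [hz.isWeakGradient.gradient_mollify hzi.locallyIntegrable hDi.locallyIntegrable] at this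

end Duality

end PQComparison

/-! ### Localization to a compact subset of `Ω`. -/

namespace PQComparison

open Filter Topology

variable {n : ℕ}

section Localization

/-- The points of `closure Ω` at distance at least `δ` from the frontier form a closed bounded set,
which lies in `Ω` because `Ω` is open. -/
lemma BoundaryLE.exists_compact {Ω : Set (Rn n)} (hΩ : IsOpen Ω) (hΩb : Bornology.IsBounded Ω)
    {u v : Rn n → ℝ} (h : BoundaryLE Ω u v) {k : ℝ} (hk : 0 < k) :
    ∃ K ⊆ Ω, IsCompact K ∧ ∀ᵐ x ∂(volume.restrict Ω), x ∉ K → u x - v x ≤ k := by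
  obtain ⟨δ, hδ, hae⟩ := h k hk
  refine ⟨closure Ω ∩ {x | δ ≤ Metric.infDist x (frontier Ω)}, ?_, ?_, ?_⟩
  · rintro x ⟨hx, hxδ⟩
    by_contra hxΩ
    have hf : x ∈ frontier Ω := by rw [hΩ.frontier_eq]; exact ⟨hx, hxΩ⟩
    have : δ ≤ Metric.infDist x (frontier Ω) := hxδ
    rw [Metric.infDist_zero_of_mem hf] at this
    linarith
  · exact (hΩb.isCompact_closure).inter_right
      (isClosed_le continuous_const (Metric.continuous_infDist_pt _))
  · filter_upwards [hae, ae_restrict_mem hΩ.measurableSet] with x hx hxΩ hxK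
    refine hx ?_
    by_contra hcon
    exact hxK ⟨subset_closure hxΩ, not_lt.1 hcon⟩

lemma exists_cutoff {Ω K : Set (Rn n)} (hΩ : IsOpen Ω) (hK : IsCompact K) (hKΩ : K ⊆ Ω) :
    ∃ χ : Rn n → ℝ, ContDiff ℝ (⊤ : ℕ∞) χ ∧ HasCompactSupport χ ∧ tsupport χ ⊆ Ω ∧
      (∀ x, χ x ∈ Icc (0 : ℝ) 1) ∧ ∀ x ∈ K, χ x = 1 := by
  obtain ⟨δ, hδ, hδΩ⟩ := hK.exists_cthickening_subset_open hΩ hKΩ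
  obtain ⟨f, hf0, hf1, hf⟩ := exists_contMDiffMap_zero_one_of_isClosed (n := ⊤)
    (modelWithCornersSelf ℝ (Rn n)) (s := (Metric.thickening δ K)ᶜ) (t := K)
    Metric.isOpen_thickening.isClosed_compl hK.isClosed
    (disjoint_compl_left_iff_subset.2 (Metric.self_subset_thickening hδ K))
  have hsub : tsupport f ⊆ Metric.cthickening δ K := by
    refine closure_minimal (fun x hx => ?_) Metric.isClosed_cthickening
    by_contra hx'
    exact hx (hf0 fun hx'' => hx' (Metric.thickening_subset_cthickening δ K hx''))
  exact ⟨f, f.contMDiff.contDiff,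
    hK.cthickening.of_isClosed_subset (isClosed_tsupport _) hsub, hsub.trans hδΩ, hf,
    fun x hx => hf1 hx⟩

/-- The value `1` is the maximum of the cutoff, so it need not be constant near `x`. -/
lemma gradient_eq_zero_of_eq_one {χ : Rn n → ℝ} (hχ : ∀ x, χ x ∈ Icc (0 : ℝ) 1) {x : Rn n}
    (hx : χ x = 1) : gradient χ x = 0 := by
  have hmax : IsLocalMax χ x := Eventually.of_forall fun y => by rw [hx]; exact (hχ y).2
  simp [gradient, hmax.fderiv_eq_zero]

lemma gradient_mul {χ φ : Rn n → ℝ} {x : Rn n} (hχ : DifferentiableAt ℝ χ x)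
    (hφ : DifferentiableAt ℝ φ x) :
    gradient (fun y => χ y * φ y) x = χ x • gradient φ x + φ x • gradient χ x := by
  simp [gradient, fderiv_fun_mul hχ hφ]

lemma memLp_of_restrict_of_eq_zero {F : Type*} [NormedAddCommGroup F] {K : Set (Rn n)}
    (hK : MeasurableSet K) {s : ℝ≥0∞} {f : Rn n → F} (h : MemLp f s (volume.restrict K))
    (hf : ∀ x ∉ K, f x = 0) : MemLp f s := by
  have : K.indicator f = f := indicator_eq_self.2 fun x hx => by_contra fun h' => hx (hf x h')
  rw [← this]
  exact (memLp_indicator_iff_restrict hK).2 h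

/-- Localization of a Sobolev function by a cutoff function. -/
lemma MemW1Loc.memW1Supported_mul {Ω : Set (Rn n)} {s : ℝ≥0∞} (hs : 1 ≤ s)
    {u : Rn n → ℝ} {Du : Rn n → Rn n} (h : MemW1Loc Ω s u Du) {χ : Rn n → ℝ}
    (hχ : ContDiff ℝ (⊤ : ℕ∞) χ) (hc : HasCompactSupport χ) (hsub : tsupport χ ⊆ Ω) :
    MemW1Supported s (tsupport χ) (fun x => χ x * u x)
      (fun x => χ x • Du x + u x • gradient χ x) := by
  have hχ1 : ContDiff ℝ 1 χ := hχ.of_le (by exact_mod_cast le_top)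
  have hmeas : MeasurableSet (tsupport χ) := (isClosed_tsupport χ).measurableSet
  obtain ⟨B, hB⟩ := hc.exists_bound_of_continuous hχ1.continuous
  obtain ⟨B', hB'0, hB'⟩ := exists_norm_gradient_le hχ1 hc
  have hχ0 : ∀ x ∉ tsupport χ, χ x = 0 := fun x hx => image_eq_zero_of_notMem_tsupport hx
  have hg0 : ∀ x ∉ tsupport χ, gradient χ x = 0 := by
    intro x hx
    have : fderiv ℝ χ x = 0 := by
      by_contra h'
      exact hx (support_fderiv_subset ℝ h')
    simp [gradient, this]
  have huK := h.memLp _ hsub hc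
  have hDK := h.memLp_grad _ hsub hc
  have m1 : MemLp (fun x => χ x * u x) s := by
    refine memLp_of_restrict_of_eq_zero hmeas ?_ fun x hx => by simp [hχ0 x hx]
    refine huK.of_le_mul (c := B) (hχ1.continuous.aestronglyMeasurable.mul huK.1)
      (Eventually.of_forall fun x => ?_)
    rw [norm_mul]
    exact mul_le_mul_of_nonneg_right (hB x) (norm_nonneg _)
  have m2 : MemLp (fun x => χ x • Du x) s := by
    refine memLp_of_restrict_of_eq_zero hmeas ?_ fun x hx => by simp [hχ0 x hx]
    refine hDK.of_le_mul (c := B) (hχ1.continuous.aestronglyMeasurable.smul hDK.1)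
      (Eventually.of_forall fun x => ?_)
    rw [norm_smul]
    exact mul_le_mul_of_nonneg_right (hB x) (norm_nonneg _)
  have m3 : MemLp (fun x => u x • gradient χ x) s := by
    refine memLp_of_restrict_of_eq_zero hmeas ?_ fun x hx => by simp [hg0 x hx]
    refine huK.of_le_mul (c := B')
      (huK.1.smul (continuous_gradient hχ1).aestronglyMeasurable)
      (Eventually.of_forall fun x => ?_)
    rw [norm_smul, mul_comm]
    exact mul_le_mul_of_nonneg_right (hB' x) (norm_nonneg _)
  refine ⟨m1, m2.add m3, fun x hx => by simp [hχ0 x hx],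
    fun x hx => by simp [hχ0 x hx, hg0 x hx], fun φ hφ hφc => ?_⟩
  have hφ1 : ContDiff ℝ 1 φ := hφ.of_le (by exact_mod_cast le_top)
  -- Testing with `χ φ`, which is supported in `Ω`, produces the product rule.
  have hw := h.isWeakGradient (fun x => χ x * φ x) (hχ.mul hφ) hc.mul_right
    ((tsupport_mul_subset_left).trans hsub)
  have hgrad : ∀ x, gradient (fun y => χ y * φ y) x = χ x • gradient φ x + φ x • gradient χ x :=
    fun x => gradient_mul (hχ1.differentiable one_ne_zero x) (hφ1.differentiable one_ne_zero x)
  simp_rw [hgrad] at hw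
  rw [setIntegral_eq_integral_of_forall_compl_eq_zero
      fun x hx => by simp [hχ0 x fun h' => hx (hsub h'), hg0 x fun h' => hx (hsub h')],
    setIntegral_eq_integral_of_forall_compl_eq_zero
      fun x hx => by simp [hχ0 x fun h' => hx (hsub h')]] at hw
  have i1 : Integrable fun x => (χ x * u x) • gradient φ x :=
    (m1.locallyIntegrable hs).integrable_smul_right_of_hasCompactSupport (continuous_gradient hφ1)
      (hasCompactSupport_gradient hφc)
  have i2 : Integrable fun x => φ x • (u x • gradient χ x) :=
    (m3.locallyIntegrable hs).integrable_smul_left_of_hasCompactSupport hφ1.continuous hφc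
  have i3 : Integrable fun x => φ x • (χ x • Du x) :=
    (m2.locallyIntegrable hs).integrable_smul_left_of_hasCompactSupport hφ1.continuous hφc
  have e1 : (fun x => u x • (χ x • gradient φ x + φ x • gradient χ x)) =
      fun x => (χ x * u x) • gradient φ x + φ x • (u x • gradient χ x) := by
    funext x
    rw [smul_add, smul_smul, mul_comm (u x), smul_comm (u x)]
  have e2 : (fun x => (χ x * φ x) • Du x) = fun x => φ x • (χ x • Du x) := by
    funext x
    rw [smul_smul, mul_comm]
  rw [e1, e2, integral_add i1 i2] at hw
  simp_rw [smul_add]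
  rw [integral_add i3 i2, neg_add, ← hw]
  abel

lemma MemW1Supported.sub {s : ℝ≥0∞} (hs : 1 ≤ s) {K : Set (Rn n)} {z z' : Rn n → ℝ}
    {Dz Dz' : Rn n → Rn n} (h : MemW1Supported s K z Dz) (h' : MemW1Supported s K z' Dz') :
    MemW1Supported s K (fun x => z x - z' x) (fun x => Dz x - Dz' x) where
  memLp := h.memLp.sub h'.memLp
  memLp_grad := h.memLp_grad.sub h'.memLp_grad
  eq_zero x hx := by simp [h.eq_zero x hx, h'.eq_zero x hx]
  grad_eq_zero x hx := by simp [h.grad_eq_zero x hx, h'.grad_eq_zero x hx]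
  isWeakGradient φ hφ hc := by
    have hφ1 : ContDiff ℝ 1 φ := hφ.of_le (by exact_mod_cast le_top)
    have i1 : ∀ {f : Rn n → ℝ}, MemLp f s → Integrable fun x => f x • gradient φ x := fun hf =>
      (hf.locallyIntegrable hs).integrable_smul_right_of_hasCompactSupport (continuous_gradient hφ1)
        (hasCompactSupport_gradient hc)
    have i2 : ∀ {f : Rn n → Rn n}, MemLp f s → Integrable fun x => φ x • f x := fun hf =>
      (hf.locallyIntegrable hs).integrable_smul_left_of_hasCompactSupport hφ1.continuous hc
    simp_rw [sub_smul, smul_sub]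
    rw [integral_sub (i1 h.memLp) (i1 h'.memLp), integral_sub (i2 h.memLp_grad) (i2 h'.memLp_grad),
      h.isWeakGradient φ hφ hc, h'.isWeakGradient φ hφ hc]
    abel

end Localization

/-! ### Growth of the lower order terms. -/

section Hamiltonian

variable {Ω : Set (Rn n)} {H : Rn n → ℝ → Rn n → ℝ} {σ : ℝ} {u v : Rn n → ℝ}
  {Du Dv : Rn n → Rn n}

/-- The Lipschitz condition in the gradient variable along a given function. -/
def LipschitzAlong (Ω : Set (Rn n)) (H : Rn n → ℝ → Rn n → ℝ) (σ : ℝ) (u : Rn n → ℝ) : Prop :=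
  ∀ K : Set (Rn n), K ⊆ Ω → IsCompact K → ∃ M : ℝ, 0 < M ∧ ∀ᵐ x ∂(volume.restrict K),
    ∀ ξ η : Rn n, |H x (u x) η - H x (u x) ξ| ≤ M * |‖η‖ ^ σ - ‖ξ‖ ^ σ|

lemma CondH2.lipschitzAlong (h : CondH2 Ω H σ) (u : Rn n → ℝ) : LipschitzAlong Ω H σ u := by
  intro K hKΩ hK
  obtain ⟨M, hM, hb⟩ := h K hKΩ hK
  refine ⟨M, hM, ?_⟩
  filter_upwards [ae_restrict_mem hK.measurableSet] with x hx
  exact hb x hx (u x)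

lemma CondH2Weak.lipschitzAlong (h : CondH2Weak Ω H σ) (hu : LocMemLp Ω ∞ u) :
    LipschitzAlong Ω H σ u := by
  intro K hKΩ hK
  obtain ⟨C, -, hC⟩ := ae_norm_le_of_memLp_top (hu K hKΩ hK)
  obtain ⟨M, hM, hb⟩ := h K hKΩ hK (Metric.closedBall 0 C) (isCompact_closedBall 0 C)
  refine ⟨M, hM, ?_⟩
  filter_upwards [ae_restrict_mem hK.measurableSet, hC] with x hx hxC
  exact hb x hx (u x) (mem_closedBall_zero_iff.2 hxC)

/-- A lower semicontinuous function attains its minimum on a compact set, so positivity at `r = k`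
is uniform over `K`; monotonicity carries the bound to all larger `r`. -/
lemma IsModulus.exists_pos_le {ω : Rn n → ℝ → ℝ} (hω : IsModulus Ω ω) (hpos : PosModulus Ω ω)
    {K : Set (Rn n)} (hK : IsCompact K) (hKΩ : K ⊆ Ω) {k : ℝ} (hk : 0 < k) :
    ∃ c : ℝ, 0 < c ∧ ∀ x ∈ K, ∀ r : ℝ, k ≤ r → c ≤ ω x r := by
  rcases K.eq_empty_or_nonempty with rfl | hne
  · exact ⟨1, one_pos, by simp⟩
  obtain ⟨x₀, hx₀, hmin⟩ := LowerSemicontinuousOn.exists_isMinOn hne hK ((hω.lsc k hk).mono hKΩ)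
  exact ⟨ω x₀ k, hpos x₀ (hKΩ hx₀) k hk, fun x hx r hr =>
    (isMinOn_iff.1 hmin x hx).trans (hω.mono x (hKΩ hx) hk (hk.trans_le hr) hr)⟩

/-- Pass through `H x s ξ`: the Lipschitz bound is then needed only at the smaller value `s`, and
the change from `s` to `t` takes place at the gradient `ξ`. -/
lemma CondH1.sub_le {ω τ : Rn n → ℝ → ℝ} (h : CondH1 Ω H ω τ σ) {x : Rn n} (hx : x ∈ Ω)
    {s t M : ℝ} (hst : s < t) {ξ η : Rn n}
    (hM : ∀ ξ η : Rn n, |H x s η - H x s ξ| ≤ M * |‖η‖ ^ σ - ‖ξ‖ ^ σ|) :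
    H x s η - H x t ξ ≤
      M * |‖η‖ ^ σ - ‖ξ‖ ^ σ| - τ x (t - s) * ‖ξ‖ ^ σ - ω x (t - s) := by
  have h1 := h.ineq x hx ξ s t hst
  have h2 := (le_abs_self _).trans (hM ξ η)
  linarith

/-- The difference of the lower order terms is controlled by powers of the gradient of the
difference. -/
lemma exists_growth_bound {p q : ℝ} (hp : 2 ≤ p) (hqp : q ≤ p) {ω τ : Rn n → ℝ → ℝ} (hσ : 0 < σ)
    (h1 : CondH1 Ω H ω τ σ) (h2 : LipschitzAlong Ω H σ v)
    (hcase : (σ ≤ 1 ∧ PosModulus Ω ω) ∨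
      (σ ≤ max q 2 - 1 ∧ PosModulus Ω ω ∧ PosModulus Ω τ) ∨
      (max q 2 - 1 ≤ σ ∧ σ ≤ p - 1 ∧ PosModulus Ω τ) ∨
      (p - 1 ≤ σ ∧ σ ≤ p ∧ PosModulus Ω τ ∧
        ∃ Λ : ℝ, ∀ᵐ x ∂(volume.restrict Ω), u x - v x ≤ Λ) ∨
      (p ≤ σ ∧ PosModulus Ω τ ∧ LocMemLp Ω ∞ Du ∧ LocMemLp Ω ∞ Dv))
    {K : Set (Rn n)} (hK : IsCompact K) (hKΩ : K ⊆ Ω) {k : ℝ} (hk : 0 < k) :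
    ∃ r ∈ Icc (max 2 q) p, ∃ C C' : ℝ, 0 ≤ C ∧ 0 ≤ C' ∧
      (C' = 0 ∨ ∃ Λ : ℝ, ∀ᵐ x ∂(volume.restrict Ω), u x - v x ≤ Λ) ∧
      ∀ᵐ x ∂(volume.restrict K), k < u x - v x →
        H x (v x) (Dv x) - H x (u x) (Du x) ≤
          C * ‖Du x - Dv x‖ ^ (r - 1) + C' * ‖Du x - Dv x‖ ^ r := by
  obtain ⟨M, hM, hML⟩ := h2 K hKΩ hK
  have hmem := ae_restrict_mem (μ := volume) hK.measurableSet
  have hrpow : ∀ x : Rn n, 0 ≤ ‖Du x‖ ^ σ := fun x => by positivity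
  have hdist : ∀ x : Rn n, |‖Du x‖ - ‖Dv x‖| ≤ ‖Du x - Dv x‖ := fun x => abs_norm_sub_norm_le _ _
  have hmax : max 2 q ∈ Icc (max 2 q) p := ⟨le_rfl, max_le hp hqp⟩
  have hmax2 : 2 ≤ max 2 q := le_max_left _ _
  have hpmem : p ∈ Icc (max 2 q) p := ⟨max_le hp hqp, le_rfl⟩
  -- estimate when only `τ` is positive
  have htau : PosModulus Ω τ → ∃ C : ℝ, 0 < C ∧ ∀ᵐ x ∂(volume.restrict K), k < u x - v x →
      H x (v x) (Dv x) - H x (u x) (Du x) ≤ C * ‖Du x - Dv x‖ ^ σ - ω x (u x - v x) := by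
    intro hτ
    obtain ⟨c, hc, hcτ⟩ := h1.tau.exists_pos_le hτ hK hKΩ hk
    obtain ⟨C, hC, hCb⟩ := exists_abs_rpow_sub_rpow_le hσ hc hM
    refine ⟨C, hC, ?_⟩
    filter_upwards [hML, hmem] with x hx hxK hxk
    have e1 := h1.sub_le (hKΩ hxK) (by linarith : v x < u x) (ξ := Du x) (η := Dv x) hx
    have e2 := hCb _ _ _ (norm_nonneg (Du x)) (norm_nonneg (Dv x)) (hdist x)
    have e3 := mul_le_mul_of_nonneg_right (hcτ x hxK _ hxk.le) (hrpow x)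
    linarith
  -- estimate when `ω` is positive and the exponent is small
  have homega : PosModulus Ω ω → σ ≤ max 2 q - 1 → ∀ C : ℝ, 0 < C →
      (∀ᵐ x ∂(volume.restrict K), k < u x - v x →
        H x (v x) (Dv x) - H x (u x) (Du x) ≤ C * ‖Du x - Dv x‖ ^ σ - ω x (u x - v x)) →
      ∃ C₁ : ℝ, 0 ≤ C₁ ∧ ∀ᵐ x ∂(volume.restrict K), k < u x - v x →
        H x (v x) (Dv x) - H x (u x) (Du x) ≤ C₁ * ‖Du x - Dv x‖ ^ (max 2 q - 1) := by
    intro hω hσq C hC hae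
    obtain ⟨c, hc, hcω⟩ := h1.omega.exists_pos_le hω hK hKΩ hk
    obtain ⟨C₁, hC₁, hb⟩ := exists_mul_rpow_le_add hσ hσq hC hc
    refine ⟨C₁, hC₁.le, ?_⟩
    filter_upwards [hae, hmem] with x hx hxK hxk
    have e1 := hx hxk
    have e2 := hb _ (norm_nonneg (Du x - Dv x))
    have e3 := hcω x hxK _ hxk.le
    linarith
  have hωnn : ∀ x ∈ K, k < u x - v x → 0 ≤ ω x (u x - v x) := fun x hx hxk =>
    h1.omega.nonneg x (hKΩ hx) _ (hk.trans hxk)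
  -- The exponent `r` is `max 2 q` when `ω` absorbs a low power, `σ + 1` in the intermediate range,
  -- and `p` for larger `σ`.
  rcases hcase with ⟨hσ1, hω⟩ | ⟨hσ2, hω, hτ⟩ | ⟨hσ1, hσ2, hτ⟩ | ⟨hσ1, hσ2, hτ, hΛ⟩ |
    ⟨hσ1, hτ, hDu, hDv⟩
  · obtain ⟨C₁, hC₁, hae⟩ := homega hω (by linarith) M hM (by
      filter_upwards [hML, hmem] with x hx hxK hxk
      have e1 := h1.sub_le (hKΩ hxK) (by linarith : v x < u x) (ξ := Du x) (η := Dv x) hx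
      have e2 := abs_rpow_sub_rpow_le hσ hσ1 (norm_nonneg (Du x)) (norm_nonneg (Dv x)) (hdist x)
      have e3 := mul_le_mul_of_nonneg_left e2 hM.le
      have e4 := mul_nonneg (h1.tau.nonneg x (hKΩ hxK) _ (hk.trans hxk)) (hrpow x)
      linarith)
    exact ⟨max 2 q, hmax, C₁, 0, hC₁, le_rfl, Or.inl rfl, by simpa using hae⟩
  · obtain ⟨C, hC, hae⟩ := htau hτ
    obtain ⟨C₁, hC₁, hae⟩ := homega hω (by rwa [max_comm] at hσ2) C hC hae
    exact ⟨max 2 q, hmax, C₁, 0, hC₁, le_rfl, Or.inl rfl, by simpa using hae⟩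
  · obtain ⟨C, hC, hae⟩ := htau hτ
    rw [max_comm] at hσ1
    refine ⟨σ + 1, ⟨by linarith, by linarith⟩, C, 0, hC.le, le_rfl, Or.inl rfl, ?_⟩
    filter_upwards [hae, hmem] with x hx hxK hxk
    have e1 := hx hxk
    have e2 := hωnn x hxK hxk
    rw [add_sub_cancel_right, zero_mul, add_zero]
    linarith
  · obtain ⟨C, hC, hae⟩ := htau hτ
    -- Here `t ^ σ ≤ t ^ (p - 1) + t ^ p`. The second power can be absorbed only through a small
    -- test function, hence the bound on `u - v`.
    refine ⟨p, hpmem, C, C, hC.le, hC.le, Or.inr hΛ, ?_⟩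
    filter_upwards [hae, hmem] with x hx hxK hxk
    have e1 := hx hxk
    have e2 := hωnn x hxK hxk
    have e3 := mul_le_mul_of_nonneg_left (rpow_le_rpow_add_rpow (norm_nonneg (Du x - Dv x))
      (by linarith : 0 < p - 1) hσ1 hσ2) hC.le
    linarith
  · obtain ⟨C, hC, hae⟩ := htau hτ
    obtain ⟨L₁, hL₁, hae₁⟩ := ae_norm_le_of_memLp_top (hDu K hKΩ hK)
    obtain ⟨L₂, hL₂, hae₂⟩ := ae_norm_le_of_memLp_top (hDv K hKΩ hK)
    -- The excess power `σ - (p - 1)` is bounded by means of the local bounds of both gradients, so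
    -- no term of order `p` remains.
    refine ⟨p, hpmem, C * (L₁ + L₂) ^ (σ - (p - 1)), 0, by positivity, le_rfl, Or.inl rfl, ?_⟩
    filter_upwards [hae, hmem, hae₁, hae₂] with x hx hxK hx₁ hx₂ hxk
    have e1 := hx hxk
    have e2 := hωnn x hxK hxk
    have e3 : ‖Du x - Dv x‖ ≤ L₁ + L₂ := (norm_sub_le _ _).trans (add_le_add hx₁ hx₂)
    have e4 : ‖Du x - Dv x‖ ^ σ ≤
        (L₁ + L₂) ^ (σ - (p - 1)) * ‖Du x - Dv x‖ ^ (p - 1) := by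
      have e5 : ‖Du x - Dv x‖ ^ σ =
          ‖Du x - Dv x‖ ^ (σ - (p - 1)) * ‖Du x - Dv x‖ ^ (p - 1) := by
        rw [← Real.rpow_add_of_nonneg (norm_nonneg _) (by linarith) (by linarith)]
        ring_nf
      rw [e5]
      gcongr
      linarith
    have e6 := mul_le_mul_of_nonneg_left e4 hC.le
    linarith

end Hamiltonian

/-! ### Integrability of the lower order terms. -/

section Integrability

variable {Ω : Set (Rn n)} {H : Rn n → ℝ → Rn n → ℝ} {σ : ℝ} {u : Rn n → ℝ} {Du : Rn n → Rn n}

/-- Extension by zero off `Ω` turns `H`, continuous only over `Ω`, into a Borel function that can be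
composed with measurable maps. -/
lemma aestronglyMeasurable_hamiltonian (hΩ : IsOpen Ω)
    (hH : ContinuousOn (fun z : Rn n × ℝ × Rn n => H z.1 z.2.1 z.2.2) (Ω ×ˢ Set.univ))
    {K : Set (Rn n)} (hK : MeasurableSet K) (hKΩ : K ⊆ Ω)
    (hu : AEStronglyMeasurable u (volume.restrict K))
    (hDu : AEStronglyMeasurable Du (volume.restrict K)) :
    AEStronglyMeasurable (fun x => H x (u x) (Du x)) (volume.restrict K) := by
  classical
  have hmeas : Measurable ((Ω ×ˢ (Set.univ : Set (ℝ × Rn n))).piecewise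
      (fun z : Rn n × ℝ × Rn n => H z.1 z.2.1 z.2.2) fun _ => 0) :=
    hH.measurable_piecewise continuousOn_const (hΩ.measurableSet.prod MeasurableSet.univ)
  have hcomp := hmeas.comp_aemeasurable
    (aemeasurable_id.prodMk (hu.aemeasurable.prodMk hDu.aemeasurable))
  refine (hcomp.congr ?_).aestronglyMeasurable
  filter_upwards [ae_restrict_mem hK] with x hx
  simp [piecewise, hKΩ hx]

/-- The Lipschitz condition compared with the zero gradient bounds `|H(x,u,∇u)|` by `|H(x,u,0)| +
M|∇u|^σ`. -/
lemma locMemLp_hamiltonian (hΩ : IsOpen Ω)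
    (hH : ContinuousOn (fun z : Rn n × ℝ × Rn n => H z.1 z.2.1 z.2.2) (Ω ×ˢ Set.univ))
    (hσ : 0 < σ) (h2 : LipschitzAlong Ω H σ u) {s s' : ℝ≥0∞} (hu : LocMemLp Ω s u)
    (hDu : LocMemLp Ω s Du) (h0 : LocMemLp Ω s' fun x => H x (u x) 0)
    (hpow : LocMemLp Ω s' fun x => ‖Du x‖ ^ σ) :
    LocMemLp Ω s' fun x => H x (u x) (Du x) := by
  intro K hKΩ hK
  obtain ⟨M, hM, hML⟩ := h2 K hKΩ hK
  have hmeas := aestronglyMeasurable_hamiltonian hΩ hH hK.measurableSet hKΩ (hu K hKΩ hK).1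
    (hDu K hKΩ hK).1
  refine ((h0 K hKΩ hK).norm.add ((hpow K hKΩ hK).const_mul M)).mono hmeas ?_
  filter_upwards [hML] with x hx
  have h1 := hx 0 (Du x)
  rw [norm_zero, Real.zero_rpow hσ.ne', sub_zero,
    abs_of_nonneg (Real.rpow_nonneg (norm_nonneg (Du x)) σ)] at h1
  have h3 : |H x (u x) (Du x)| ≤ |H x (u x) 0| + M * ‖Du x‖ ^ σ := by
    have := abs_add_le (H x (u x) 0) (H x (u x) (Du x) - H x (u x) 0)
    rw [add_sub_cancel] at this
    linarith
  simp only [Pi.add_apply, Real.norm_eq_abs]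
  rw [abs_of_nonneg (by positivity : 0 ≤ |H x (u x) 0| + M * ‖Du x‖ ^ σ)]
  exact h3

/-- On a compact set `|∇u|^σ ≤ 1 + |∇u|^e`, and `|∇u|^e` has integrability `p / e`. The useful
values are `e = p - 1`, the exponent dual to `p`, and `e = p`, giving `L¹`. -/
lemma locMemLp_norm_rpow {p e : ℝ} (hσ : 0 < σ) (he : σ ≤ e)
    (hDu : LocMemLp Ω (ENNReal.ofReal p) Du) :
    LocMemLp Ω (ENNReal.ofReal (p / e)) fun x => ‖Du x‖ ^ σ := by
  intro K hKΩ hK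
  have hD := hDu K hKΩ hK
  have he0 : 0 < e := by linarith
  have : IsFiniteMeasure ((volume : Measure (Rn n)).restrict K) :=
    isFiniteMeasure_restrict.2 hK.measure_lt_top.ne
  have h1 := hD.norm_rpow_div (ENNReal.ofReal e)
  rw [ENNReal.toReal_ofReal he0.le, ← ENNReal.ofReal_div_of_pos he0] at h1
  refine ((memLp_const (1 : ℝ)).add h1).mono
    ((hD.1.norm.aemeasurable.pow_const σ).aestronglyMeasurable)
    (Eventually.of_forall fun x => ?_)
  simp only [Pi.add_apply, Real.norm_eq_abs]
  rw [abs_of_nonneg (by positivity), abs_of_nonneg (by positivity)]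
  rcases le_total ‖Du x‖ 1 with h | h
  · have := Real.rpow_le_one (norm_nonneg (Du x)) h hσ.le
    have := Real.rpow_nonneg (norm_nonneg (Du x)) e
    linarith
  · have := Real.rpow_le_rpow_of_exponent_le h he
    linarith

lemma locMemLp_one_norm_rpow_of_top (hσ : 0 < σ) (hDu : LocMemLp Ω ∞ Du) :
    LocMemLp Ω 1 fun x => ‖Du x‖ ^ σ := by
  intro K hKΩ hK
  have hD := hDu K hKΩ hK
  have : IsFiniteMeasure ((volume : Measure (Rn n)).restrict K) :=
    isFiniteMeasure_restrict.2 hK.measure_lt_top.ne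
  obtain ⟨C, hC, hae⟩ := ae_norm_le_of_memLp_top hD
  refine MemLp.of_bound ((hD.1.norm.aemeasurable.pow_const σ).aestronglyMeasurable) (C ^ σ) ?_
  filter_upwards [hae] with x hx
  rw [Real.norm_of_nonneg (by positivity)]
  exact Real.rpow_le_rpow (norm_nonneg _) hx hσ.le

end Integrability

end PQComparison

/-! ### The energy estimate and the comparison principle. -/

namespace PQComparison

open Filter Topology

variable {n : ℕ}

/-- The integral of a non-integrable function is `0` by convention, so non-negativity of `g` makes
integrability of `f` unnecessary. -/
lemma integral_le_integral_of_nonneg_right {α : Type*} [MeasurableSpace α] {μ : Measure α}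
    {f g : α → ℝ} (hg : Integrable g μ) (hg0 : 0 ≤ᵐ[μ] g) (h : f ≤ᵐ[μ] g) :
    ∫ x, f x ∂μ ≤ ∫ x, g x ∂μ := by
  by_cases hf : Integrable f μ
  · exact integral_mono_ae hf hg h
  · rw [integral_undef hf]
    exact integral_nonneg_of_ae hg0

lemma integrable_norm_rpow_of_memLp {F : Type*} [NormedAddCommGroup F] {α : Type*}
    [MeasurableSpace α] {μ : Measure α} {r : ℝ} (hr : 0 < r) {f : α → F}
    (hf : MemLp f (ENNReal.ofReal r) μ) : Integrable (fun x => ‖f x‖ ^ r) μ := by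
  have := hf.integrable_norm_rpow (by simpa using hr) ENNReal.ofReal_ne_top
  rwa [ENNReal.toReal_ofReal hr.le] at this

lemma ofReal_integral_norm_rpow {F : Type*} [NormedAddCommGroup F] {α : Type*}
    [MeasurableSpace α] {μ : Measure α} {r : ℝ} (hr : 0 < r) {f : α → F}
    (hf : MemLp f (ENNReal.ofReal r) μ) :
    ENNReal.ofReal (∫ x, ‖f x‖ ^ r ∂μ) = ∫⁻ x, ‖f x‖ₑ ^ r ∂μ := by
  rw [ofReal_integral_eq_lintegral_ofReal (integrable_norm_rpow_of_memLp hr hf)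
    (Eventually.of_forall fun x => by positivity)]
  refine lintegral_congr fun x => ?_
  rw [← ENNReal.ofReal_rpow_of_nonneg (norm_nonneg _) hr.le, ofReal_norm]

/-- The energy estimate on superlevel sets, obtained by testing a weak differential inequality with
a truncation. -/
lemma energy_le {Ω K : Set (Rn n)} (hΩ : IsOpen Ω) (hK : IsCompact K) (hKΩ : K ⊆ Ω) {s : ℝ≥0∞}
    (hs : 1 ≤ s) {r : ℝ} (hr : 1 < r) (hrs : ENNReal.ofReal r ≤ s) {z : Rn n → ℝ}
    {Dz : Rn n → Rn n} (hz : MemW1Supported s K z Dz) {k δ : ℝ} (hk : 0 < k) {g : Rn n → Rn n}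
    {b : Rn n → ℝ}
    (hweak : ∀ φ : Rn n → ℝ, ContDiff ℝ 1 φ → HasCompactSupport φ → tsupport φ ⊆ Ω →
      (∀ x, 0 ≤ φ x) → ∫ x in Ω, inner ℝ (g x) (gradient φ x) ≤ ∫ x in Ω, b x * φ x)
    (hg : LocDual Ω g ({x | k < z x}.indicator Dz)) (hb : LocDual Ω b fun x => max (z x - k) 0)
    {γ C C₁ C' : ℝ} (hγ : 0 < γ) (hC₁ : 0 ≤ C₁)
    (hyoung : ∀ t y : ℝ, 0 ≤ t → 0 ≤ y → C * t ^ (r - 1) * y ≤ γ / 4 * t ^ r + C₁ * y ^ r)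
    (hC' : 0 ≤ C') (hδ : C' * δ ≤ γ / 4) (hbdd : C' = 0 ∨ ∀ᵐ x, z x ≤ k + δ)
    (hell : ∀ᵐ x, k < z x → γ * ‖Dz x‖ ^ r ≤ inner ℝ (g x) (Dz x))
    (hgrowth : ∀ᵐ x, k < z x → b x ≤ C * ‖Dz x‖ ^ (r - 1) + C' * ‖Dz x‖ ^ r) :
    ∫⁻ x, ‖{x | k < z x}.indicator Dz x‖ₑ ^ r ≤
      ENNReal.ofReal (2 * C₁ / γ) *
        ∫⁻ x in {x | k < z x ∧ Dz x ≠ 0}, ‖max (z x - k) 0‖ₑ ^ r := by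
  have hr0 : 0 < r := by linarith
  have hzk := hz.posPart hK hs hk
  have hzr := hzk.mono_exponent hK hrs
  set w : Rn n → ℝ := fun x => max (z x - k) 0 with hw
  set Dw : Rn n → Rn n := {x | k < z x}.indicator Dz with hDw
  set A : Set (Rn n) := {x | k < z x ∧ Dz x ≠ 0} with hA
  have hAm : NullMeasurableSet A := by
    have h0 : NullMeasurableSet {x | Dz x = 0} :=
      hz.memLp_grad.1.nullMeasurableSet_eq_fun aestronglyMeasurable_const
    exact (nullMeasurableSet_lt aemeasurable_const hz.memLp.1.aemeasurable).inter h0.compl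
  have hw0 : ∀ x, 0 ≤ w x := fun x => le_max_right _ _
  have hmain := integral_inner_grad_le hΩ hK hKΩ hs hzk hw0 hweak hg hb
  have iD : Integrable fun x => ‖Dw x‖ ^ r := integrable_norm_rpow_of_memLp hr0 hzr.memLp_grad
  have iw : Integrable fun x => ‖w x‖ ^ r := integrable_norm_rpow_of_memLp hr0 hzr.memLp
  have iA : Integrable (A.indicator fun x => ‖w x‖ ^ r) := iw.indicator₀ hAm
  have hlower : γ * ∫ x, ‖Dw x‖ ^ r ≤ ∫ x in Ω, inner ℝ (g x) (Dw x) := by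
    rw [← setIntegral_eq_integral_of_forall_compl_eq_zero (s := Ω) (f := fun x => ‖Dw x‖ ^ r)
      fun x hx => by simp [hzk.grad_eq_zero x fun h => hx (hKΩ h), Real.zero_rpow hr0.ne'],
      ← integral_const_mul]
    refine integral_mono_ae (iD.restrict.const_mul γ)
      (hg.integrableOn hΩ hK hKΩ hzk.grad_eq_zero) ?_
    filter_upwards [ae_restrict_of_ae hell] with x hx
    by_cases hxk : k < z x
    · simpa [hDw, indicator, hxk] using hx hxk
    · simp [hDw, hxk, Real.zero_rpow hr0.ne']
  -- Of the coefficient `γ / 2`, one quarter of `γ` comes from Young's inequality and one quarter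
  -- from `C' * w ≤ γ / 4`; the other half of `γ` survives on the left.
  have hupper : ∫ x in Ω, b x * w x ≤
      ∫ x, (γ / 2 * ‖Dw x‖ ^ r + C₁ * A.indicator (fun x => ‖w x‖ ^ r) x) := by
    have hnn : ∀ x, 0 ≤ γ / 2 * ‖Dw x‖ ^ r + C₁ * A.indicator (fun x => ‖w x‖ ^ r) x := fun x =>
      add_nonneg (by positivity) (mul_nonneg hC₁ (indicator_nonneg (fun _ _ => by positivity) _))
    have hint : Integrable fun x =>
        γ / 2 * ‖Dw x‖ ^ r + C₁ * A.indicator (fun x => ‖w x‖ ^ r) x :=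
      (iD.const_mul _).add (iA.const_mul _)
    refine (integral_le_integral_of_nonneg_right hint.restrict (Eventually.of_forall hnn) ?_).trans
      (setIntegral_le_integral hint (Eventually.of_forall hnn))
    have hb' : ∀ᵐ x, C' = 0 ∨ z x ≤ k + δ := by
      rcases hbdd with h | h
      · exact Eventually.of_forall fun _ => Or.inl h
      · exact h.mono fun _ hx => Or.inr hx
    filter_upwards [ae_restrict_of_ae hgrowth, ae_restrict_of_ae hb'] with x hx hxb
    by_cases hxk : k < z x
    · have hwx : w x = z x - k := max_eq_left (by linarith)
      have hDx : Dw x = Dz x := indicator_of_mem (s := {x | k < z x}) hxk Dz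
      -- Where the gradient vanishes, both powers in the growth bound are zero and `b ≤ 0`. This
      -- restricts the error term to `A`, the set whose measure can be made small.
      by_cases hD0 : Dz x = 0
      · have h1 := hx hxk
        rw [hD0, norm_zero, Real.zero_rpow (by linarith), Real.zero_rpow hr0.ne', mul_zero,
          mul_zero, add_zero] at h1
        exact (mul_nonpos_of_nonpos_of_nonneg h1 (hw0 x)).trans (hnn x)
      · have hxA : x ∈ A := ⟨hxk, hD0⟩
        rw [indicator_of_mem hxA, hDx, Real.norm_of_nonneg (hw0 x)]
        have h1 := mul_le_mul_of_nonneg_right (hx hxk) (hw0 x)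
        have h2 := hyoung _ _ (norm_nonneg (Dz x)) (hw0 x)
        have h3 : C' * w x ≤ γ / 4 := by
          rcases hxb with h | h
          · rw [h, zero_mul]; positivity
          · refine le_trans (mul_le_mul_of_nonneg_left ?_ hC') hδ
            rw [hwx]; linarith
        have h4 := mul_le_mul_of_nonneg_right h3 (Real.rpow_nonneg (norm_nonneg (Dz x)) r)
        linarith
    · have hwx : w x = 0 := max_eq_right (by linarith)
      simpa [hwx] using hnn x
  rw [integral_add (iD.const_mul _) (iA.const_mul _), integral_const_mul, integral_const_mul,
    integral_indicator₀ hAm] at hupper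
  have hfinal : ∫ x, ‖Dw x‖ ^ r ≤ 2 * C₁ / γ * ∫ x in A, ‖w x‖ ^ r := by
    rw [div_mul_eq_mul_div, le_div_iff₀ hγ]
    linarith
  rw [← ofReal_integral_norm_rpow hr0 hzr.memLp_grad,
    ← ofReal_integral_norm_rpow hr0 (hzr.memLp.restrict A), ← ENNReal.ofReal_mul (by positivity)]
  exact ENNReal.ofReal_le_ofReal hfinal

/-- The comparison principle, with the integrability of the terms of the inequality and the growth
of the lower order terms as hypotheses. -/
theorem comparison_of_growth_bound (hn : 1 ≤ n) {Ω : Set (Rn n)} (hΩ : IsOpen Ω)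
    (hΩb : Bornology.IsBounded Ω) {p q : ℝ} (hp : 2 ≤ p) {a : Rn n → Rn n → Rn n} {γ : ℝ}
    {H : Rn n → ℝ → Rn n → ℝ} {u v : Rn n → ℝ} {Du Dv : Rn n → Rn n} (hγ : 0 < γ)
    (hell : EllipticityCond Ω p q γ a) {s : ℝ≥0∞} (hps : ENNReal.ofReal p ≤ s)
    (hu : MemW1Loc Ω s u Du) (hv : MemW1Loc Ω s v Dv)
    (hfield : (s = ENNReal.ofReal p ∧
        LocMemLp Ω (ENNReal.ofReal (p / (p - 1))) fun x => a x (Du x) - a x (Dv x)) ∨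
      (s = ∞ ∧ LocMemLp Ω 1 fun x => a x (Du x) - a x (Dv x)))
    (hlower : (s = ENNReal.ofReal p ∧ LocMemLp Ω (ENNReal.ofReal (p / (p - 1)))
        fun x => H x (v x) (Dv x) - H x (u x) (Du x)) ∨
      (LocMemLp Ω 1 (fun x => H x (v x) (Dv x) - H x (u x) (Du x)) ∧
        (s = ∞ ∨ ∃ Λ : ℝ, ∀ᵐ x ∂(volume.restrict Ω), u x - v x ≤ Λ)))
    (hgrowth : ∀ K ⊆ Ω, IsCompact K → ∀ k : ℝ, 0 < k →
      ∃ r ∈ Icc (max 2 q) p, ∃ C C' : ℝ, 0 ≤ C ∧ 0 ≤ C' ∧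
        (C' = 0 ∨ ∃ Λ : ℝ, ∀ᵐ x ∂(volume.restrict Ω), u x - v x ≤ Λ) ∧
        ∀ᵐ x ∂(volume.restrict K), k < u x - v x →
          H x (v x) (Dv x) - H x (u x) (Du x) ≤
            C * ‖Du x - Dv x‖ ^ (r - 1) + C' * ‖Du x - Dv x‖ ^ r)
    (hweak : WeakLE Ω a H u Du v Dv) (hbdry : BoundaryLE Ω u v) :
    ∀ᵐ x ∂(volume.restrict Ω), u x ≤ v x := by
  have hs : 1 ≤ s := le_trans (by simpa using by linarith) hps
  suffices hmain : ∀ k₀ : ℝ, 0 < k₀ → ∀ᵐ x ∂(volume.restrict Ω), u x - v x ≤ k₀ by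
    have h1 : ∀ i : ℕ, ∀ᵐ x ∂(volume.restrict Ω), u x - v x ≤ 1 / ((i : ℝ) + 1) :=
      fun i => hmain _ (by positivity)
    filter_upwards [ae_all_iff.2 h1] with x hx
    exact sub_nonpos.1 (ge_of_tendsto' tendsto_one_div_add_atTop_nhds_zero_nat hx)
  intro k₀ hk₀
  obtain ⟨K₀, hK₀Ω, hK₀, hout⟩ := hbdry.exists_compact hΩ hΩb hk₀
  obtain ⟨χ, hχ, hχc, hχΩ, hχ01, hχ1⟩ := exists_cutoff hΩ hK₀ hK₀Ω
  -- The cutoff makes the difference a Sobolev function on all of `ℝⁿ`. It may differ from `u - v`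
  -- off `K₀`, but there `z ≤ k₀`, so truncations at levels `k ≥ k₀` do not see the change.
  have hz := (hu.memW1Supported_mul hs hχ hχc hχΩ).sub hs (hv.memW1Supported_mul hs hχ hχc hχΩ)
  set z : Rn n → ℝ := fun x => χ x * u x - χ x * v x with hzdef
  set Dz : Rn n → Rn n := fun x =>
    (χ x • Du x + u x • gradient χ x) - (χ x • Dv x + v x • gradient χ x) with hDzdef
  set K₁ := tsupport χ with hK₁
  have hzmul : ∀ x, z x = χ x * (u x - v x) := fun x => by simp only [hzdef]; ring
  have hzK₀ : ∀ x ∈ K₀, z x = u x - v x ∧ Dz x = Du x - Dv x := by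
    intro x hx
    have h1 := hχ1 x hx
    have h2 := gradient_eq_zero_of_eq_one hχ01 h1
    exact ⟨by rw [hzmul, h1, one_mul], by simp [hDzdef, h1, h2]⟩
  have hbound : ∀ x (Λ : ℝ), 0 ≤ Λ → u x - v x ≤ Λ → z x ≤ Λ := by
    intro x Λ hΛ hx
    rw [hzmul]
    have h1 := mul_le_mul_of_nonneg_left hx (hχ01 x).1
    have h2 := mul_le_mul_of_nonneg_right (hχ01 x).2 hΛ
    linarith
  have hzero : ∀ x ∉ Ω, z x = 0 := fun x hx => hz.eq_zero x fun h => hx (hχΩ h)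
  have hzbdd : (∃ Λ : ℝ, ∀ᵐ x ∂(volume.restrict Ω), u x - v x ≤ Λ) →
      ∃ Λ : ℝ, ∀ᵐ x, z x ≤ Λ := by
    rintro ⟨Λ, hΛ⟩
    refine ⟨max Λ 0, ?_⟩
    filter_upwards [(ae_restrict_iff' hΩ.measurableSet).1 hΛ] with x hx
    by_cases hxΩ : x ∈ Ω
    · exact hbound x _ (le_max_right _ _) ((hx hxΩ).trans (le_max_left _ _))
    · rw [hzero x hxΩ]; exact le_max_right _ _
  have hlevel : ∀ᵐ x, k₀ < z x → x ∈ K₀ := by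
    filter_upwards [(ae_restrict_iff' hΩ.measurableSet).1 hout] with x hx hxz
    by_contra hxK
    by_cases hxΩ : x ∈ Ω
    · exact absurd (hbound x k₀ hk₀.le (hx hxΩ hxK)) (not_le.2 hxz)
    · rw [hzero x hxΩ] at hxz; linarith
  obtain ⟨r, hr, C, C', hC, hC', hCb, hae⟩ := hgrowth K₀ hK₀Ω hK₀ k₀ hk₀
  have hr2 : 2 ≤ r := (le_max_left _ _).trans hr.1
  have hrs : ENNReal.ofReal r ≤ s := (ENNReal.ofReal_le_ofReal hr.2).trans hps
  obtain ⟨C₁, hC₁, hyoung⟩ := exists_rpow_mul_le_add (by linarith : 1 < r) hC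
    (by positivity : 0 < γ / 4)
  -- Makes the term of order `r` cost at most `γ / 4` when the test function is at most `δ`; `C' +
  -- 1` allows `C' = 0`.
  set δ : ℝ := γ / (4 * (C' + 1)) with hδ
  have hδ0 : 0 < δ := by positivity
  have hCδ : C' * δ ≤ γ / 4 := by
    rw [hδ, mul_div_assoc', div_le_div_iff₀ (by positivity) (by norm_num)]
    nlinarith
  have hae' := (ae_restrict_iff' hK₀.measurableSet).1 hae
  have hle : ∀ᵐ x, z x ≤ k₀ := by
    refine (hz.mono_exponent hχc hrs).ae_le_of_energy_le hn hχc (by linarith) hk₀ hδ0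
      (C := ENNReal.ofReal (2 * C₁ / γ)) ENNReal.ofReal_ne_top fun k hk hkb => ?_
    have hk0 : 0 < k := hk₀.trans_le hk
    have hzk := hz.posPart hχc hs hk0
    have hg : LocDual Ω (fun x => a x (Du x) - a x (Dv x)) ({x | k < z x}.indicator Dz) := by
      rcases hfield with ⟨h1, h2⟩ | ⟨h1, h2⟩
      · exact Or.inl ⟨p, by linarith, h2, h1 ▸ hzk.memLp_grad⟩
      · exact Or.inr ⟨h2, h1 ▸ hzk.memLp_grad⟩
    have hb : LocDual Ω (fun x => H x (v x) (Dv x) - H x (u x) (Du x))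
        fun x => max (z x - k) 0 := by
      rcases hlower with ⟨h1, h2⟩ | ⟨h1, h2 | h2⟩
      · exact Or.inl ⟨p, by linarith, h2, h1 ▸ hzk.memLp⟩
      · exact Or.inr ⟨h1, h2 ▸ hzk.memLp⟩
      · obtain ⟨Λ, hΛ⟩ := hzbdd h2
        refine Or.inr ⟨h1, memLp_top_of_bound hzk.memLp.1 (max (Λ - k) 0) ?_⟩
        filter_upwards [hΛ] with x hx
        rw [Real.norm_of_nonneg (le_max_right _ _)]
        exact max_le_max (by linarith) le_rfl
    refine energy_le hΩ hχc hχΩ hs (by linarith) hrs hz hk0 hweak hg hb hγ hC₁.le hyoung hC' hCδ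
      (hCb.imp id fun h => hkb (hzbdd h)) ?_ ?_
    · filter_upwards [hlevel] with x hx hxk
      have hxK := hx (hk.trans_lt hxk)
      rw [(hzK₀ x hxK).2]
      exact hell r hr x (hK₀Ω hxK) _ _
    · filter_upwards [hlevel, hae'] with x hx hx' hxk
      have hxK := hx (hk.trans_lt hxk)
      have h1 := hzK₀ x hxK
      rw [h1.2]
      rw [h1.1] at hxk
      exact hx' hxK (hk.trans_lt hxk)
  filter_upwards [hout, ae_restrict_of_ae hle] with x hx hx'
  by_cases hxK : x ∈ K₀
  · rwa [(hzK₀ x hxK).1] at hx'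
  · exact hx hxK

end PQComparison

theorem mainTheorem1 {n : ℕ} (hn : 1 ≤ n) (Ω : Set (Rn n)) (hΩ : IsOpen Ω)
    (hΩb : Bornology.IsBounded Ω) (p q : ℝ) (hp : 2 ≤ p) (hq : 1 < q) (hqp : q ≤ p) :
    (∀ (a : Rn n → Rn n → Rn n) (γ : ℝ) (H : Rn n → ℝ → Rn n → ℝ) (ω τ : Rn n → ℝ → ℝ) (σ : ℝ)
      (u v : Rn n → ℝ) (Du Dv : Rn n → Rn n),
      IsCaratheodory Ω a →
      0 < γ → EllipticityCond Ω p q γ a →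
      ContinuousOn (fun z : Rn n × ℝ × Rn n => H z.1 z.2.1 z.2.2) (Ω ×ˢ Set.univ) →
      0 < σ → CondH1 Ω H ω τ σ →
      (CondH2 Ω H σ ∨ (CondH2Weak Ω H σ ∧ LocMemLp Ω ∞ u ∧ LocMemLp Ω ∞ v)) →
      -- either `W^{1,p}_loc` or `W^{1,∞}_loc` functions, under one of the first four conditions,
      ((((Admissible Ω (ENNReal.ofReal p) (ENNReal.ofReal (p / (p - 1))) a H u Du ∧
            Admissible Ω (ENNReal.ofReal p) (ENNReal.ofReal (p / (p - 1))) a H v Dv) ∨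
          (Admissible Ω ∞ 1 a H u Du ∧ Admissible Ω ∞ 1 a H v Dv)) ∧
        ((σ ≤ 1 ∧ PosModulus Ω ω) ∨
          (1 ≤ σ ∧ σ ≤ max q 2 - 1 ∧ PosModulus Ω ω ∧ PosModulus Ω τ) ∨
          (max q 2 - 1 ≤ σ ∧ σ ≤ p - 1 ∧ PosModulus Ω τ) ∨
          (p - 1 ≤ σ ∧ σ ≤ p ∧ PosModulus Ω τ ∧
            ∃ Λ : ℝ, ∀ᵐ x ∂(volume.restrict Ω), u x - v x ≤ Λ))) ∨
      -- or `W^{1,∞}_loc` functions under the last condition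
        ((Admissible Ω ∞ 1 a H u Du ∧ Admissible Ω ∞ 1 a H v Dv) ∧ p ≤ σ ∧ PosModulus Ω τ)) →
      WeakLE Ω a H u Du v Dv →
      BoundaryLE Ω u v →
      ∀ᵐ x ∂(volume.restrict Ω), u x ≤ v x) ∧
    -- the `(p,q)`-Laplacian is covered
    (IsCaratheodory Ω (pqField n p q) ∧ ∃ γ : ℝ, 0 < γ ∧ EllipticityCond Ω p q γ (pqField n p q)) := by

  refine ⟨?_, pqField_isCaratheodory Ω (by linarith) hq, pqField_ellipticity Ω hp hq⟩
  intro a γ H ω τ σ u v Du Dv _ hγ hell hH hσ h1 h2 hcase hweak hbdry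
  have hlip : LipschitzAlong Ω H σ u ∧ LipschitzAlong Ω H σ v := by
    rcases h2 with h2 | ⟨h2, hu, hv⟩
    · exact ⟨h2.lipschitzAlong u, h2.lipschitzAlong v⟩
    · exact ⟨h2.lipschitzAlong hu, h2.lipschitzAlong hv⟩
  have hm2 : max q 2 ≤ p := max_le hqp hp
  -- Lipschitz solutions
  have htop : Admissible Ω ∞ 1 a H u Du → Admissible Ω ∞ 1 a H v Dv →
      ((σ ≤ 1 ∧ PosModulus Ω ω) ∨
        (σ ≤ max q 2 - 1 ∧ PosModulus Ω ω ∧ PosModulus Ω τ) ∨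
        (max q 2 - 1 ≤ σ ∧ σ ≤ p - 1 ∧ PosModulus Ω τ) ∨
        (p - 1 ≤ σ ∧ σ ≤ p ∧ PosModulus Ω τ ∧
          ∃ Λ : ℝ, ∀ᵐ x ∂(volume.restrict Ω), u x - v x ≤ Λ) ∨
        (p ≤ σ ∧ PosModulus Ω τ ∧ LocMemLp Ω ∞ Du ∧ LocMemLp Ω ∞ Dv)) →
      ∀ᵐ x ∂(volume.restrict Ω), u x ≤ v x := by
    intro hu hv hc
    have hHu := locMemLp_hamiltonian hΩ hH hσ hlip.1 hu.memW1Loc.memLp hu.memW1Loc.memLp_grad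
      hu.hamiltonian (locMemLp_one_norm_rpow_of_top hσ hu.memW1Loc.memLp_grad)
    have hHv := locMemLp_hamiltonian hΩ hH hσ hlip.2 hv.memW1Loc.memLp hv.memW1Loc.memLp_grad
      hv.hamiltonian (locMemLp_one_norm_rpow_of_top hσ hv.memW1Loc.memLp_grad)
    exact comparison_of_growth_bound hn hΩ hΩb hp hγ hell le_top hu.memW1Loc hv.memW1Loc
      (Or.inr ⟨rfl, fun K hKΩ hK => (hu.field K hKΩ hK).sub (hv.field K hKΩ hK)⟩)
      (Or.inr ⟨fun K hKΩ hK => (hHv K hKΩ hK).sub (hHu K hKΩ hK), Or.inl rfl⟩)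
      (fun K hKΩ hK k hk => exists_growth_bound hp hqp hσ h1 hlip.2 hc hK hKΩ hk) hweak hbdry
  rcases hcase with ⟨⟨hu, hv⟩ | ⟨hu, hv⟩, hc⟩ | ⟨⟨hu, hv⟩, hpσ, hτ⟩
  -- For `σ ≤ p - 1` the choice `e = p - 1` places the lower order terms in the dual of `L^p`; for
  -- `σ ≤ p` only `e = p`, that is `L¹`, is available.
  · have hHam : ∀ e : ℝ, σ ≤ e → 0 < e → ∀ s' : ENNReal, s' = ENNReal.ofReal (p / e) →
        s' ≤ ENNReal.ofReal (p / (p - 1)) →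
        LocMemLp Ω s' fun x => H x (v x) (Dv x) - H x (u x) (Du x) := by
      rintro e he he0 s' rfl hs'
      have hfin : ∀ K : Set (Rn n), IsCompact K → IsFiniteMeasure (volume.restrict K) :=
        fun K hK => isFiniteMeasure_restrict.2 hK.measure_lt_top.ne
      have hHu := locMemLp_hamiltonian hΩ hH hσ hlip.1 hu.memW1Loc.memLp hu.memW1Loc.memLp_grad
        (fun K hKΩ hK => have := hfin K hK; (hu.hamiltonian K hKΩ hK).mono_exponent hs')
        (locMemLp_norm_rpow hσ he hu.memW1Loc.memLp_grad)
      have hHv := locMemLp_hamiltonian hΩ hH hσ hlip.2 hv.memW1Loc.memLp hv.memW1Loc.memLp_grad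
        (fun K hKΩ hK => have := hfin K hK; (hv.hamiltonian K hKΩ hK).mono_exponent hs')
        (locMemLp_norm_rpow hσ he hv.memW1Loc.memLp_grad)
      exact fun K hKΩ hK => (hHv K hKΩ hK).sub (hHu K hKΩ hK)
    refine comparison_of_growth_bound hn hΩ hΩb hp hγ hell le_rfl hu.memW1Loc hv.memW1Loc
      (Or.inl ⟨rfl, fun K hKΩ hK => (hu.field K hKΩ hK).sub (hv.field K hKΩ hK)⟩) ?_
      (fun K hKΩ hK k hk => exists_growth_bound hp hqp hσ h1 hlip.2 ?_ hK hKΩ hk) hweak hbdry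
    · have hsmall : σ ≤ p - 1 → LocMemLp Ω (ENNReal.ofReal (p / (p - 1)))
          fun x => H x (v x) (Dv x) - H x (u x) (Du x) := fun h =>
        hHam (p - 1) h (by linarith) _ rfl le_rfl
      rcases hc with hc | hc | hc | ⟨-, hσp, -, hΛ⟩
      · exact Or.inl ⟨rfl, hsmall (by linarith [hc.1])⟩
      · exact Or.inl ⟨rfl, hsmall (by linarith [hc.2.1])⟩
      · exact Or.inl ⟨rfl, hsmall hc.2.1⟩
      -- With mere `L¹` integrability the truncated test function must be bounded, which the upper
      -- bound on `u - v` ensures.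
      · refine Or.inr ⟨hHam p hσp (by linarith) 1 ?_ ?_, Or.inr hΛ⟩
        · rw [div_self (by linarith), ENNReal.ofReal_one]
        · rw [ENNReal.one_le_ofReal, le_div_iff₀ (by linarith)]
          linarith
    · rcases hc with hc | hc | hc | hc
      · exact Or.inl hc
      · exact Or.inr (Or.inl hc.2)
      · exact Or.inr (Or.inr (Or.inl hc))
      · exact Or.inr (Or.inr (Or.inr (Or.inl hc)))
  · refine htop hu hv ?_
    rcases hc with hc | hc | hc | hc
    · exact Or.inl hc
    · exact Or.inr (Or.inl hc.2)
    · exact Or.inr (Or.inr (Or.inl hc))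
    · exact Or.inr (Or.inr (Or.inr (Or.inl hc)))
  · exact htop hu hv (Or.inr (Or.inr (Or.inr (Or.inr
      ⟨hpσ, hτ, hu.memW1Loc.memLp_grad, hv.memW1Loc.memLp_grad⟩))))
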